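/- An additively idempotent semiring (ai-semiring) is a nonempty set $S$ with two binary operations $+,\cdot$ such that $(S,+)$ is a commutative idempotent semigroup, $(S,\cdot)$ is a semigroup, and $\cdot$ distributes over $+$ on both sides. A variety of ai-semirings is a class of ai-semirings closed under subalgebras, homomorphic images and arbitrary direct products; varieties are ordered by inclusion, $[\mathcal U,\mathcal W]$ is the set of varieties $\mathcal V$ with $\mathcal U\subseteq\mathcal V\subseteq\mathcal W$, and $\mathsf V(S)$ is the smallest variety containing $S$. Let $S_7$ be the ai-semiring on $\{\infty,a,1\}$ in which $x+x=x$, $x+y=\infty$ for $x\ne y$, $\infty$ is a multiplicative zero, $1$ is a multiplicative identity and $a\cdot a=\infty$. For distinct letters $a_1,\dots,a_r$, let $S_c(a_1\cdots a_r)$ be the set of all nonempty subwords of $a_1\cdots a_r$ in the free commutative semigroup on $a_1,\dots,a_r$ together with an element $0$; the product of two subwords is their product in the free commutative semigroup if this is again a subword of $a_1\cdots a_r$ and $0$ otherwise, $0$ is a multiplicative zero, $x+x=x$, and $x+y=0$ for $x\neq y$. Let $\mathbf N$ be the subvariety of $\mathsf V(S_7)$ determined by the identity $x^2y\approx x^2$,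 and for $k\ge1$ let $\mathbf N_k$ be the subvariety of $\mathbf N$ determined by the identity $x_1\cdots x_k\approx y_1\cdots y_k$. Then for every integer $r>2$ the interval $[\mathsf V(S_c(a_1\cdots a_r)),\mathbf N_{r+1}]$ has cardinality $2^{\aleph_0}$, and it contains both a chain and an antichain (with respect to inclusion) of cardinality $2^{\aleph_0}$. In particular, $S_7$ is of type $2^{\aleph_0}$: the variety $\mathsf V(S_7)$ has exactly $2^{\aleph_0}$ subvarieties. -/

import Mathlib

universe u

/-- Additively idempotent semirings: `(S, +)` is a commutative idempotent semigroup, `(S, *)` is a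
semigroup, and multiplication distributes over addition from both sides. No neutral elements are
required. -/
class AISemiring (S : Type u) extends Add S, Mul S where
  add_assoc : ∀ x y z : S, x + y + z = x + (y + z)
  add_comm : ∀ x y : S, x + y = y + x
  add_idem : ∀ x : S, x + x = x
  mul_assoc : ∀ x y z : S, x * y * z = x * (y * z)
  add_mul : ∀ x y z : S, (x + y) * z = x * z + y * z
  mul_add : ∀ x y z : S, x * (y + z) = x * y + x * z

/-- A (nonempty) ai-semiring, as an algebra bundled with its carrier. -/
structure AIAlg : Type (u + 1) where
  carrier : Type u
  [str : AISemiring carrier]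
  [nonempty : Nonempty carrier]

attribute [instance] AIAlg.str AIAlg.nonempty

instance AIAlg.instCoeSort : CoeSort AIAlg.{u} (Type u) := ⟨AIAlg.carrier⟩

/-- Homomorphisms of ai-semirings. -/
structure IsAIHom {S T : Type u} [AISemiring S] [AISemiring T] (f : S → T) : Prop where
  map_add : ∀ x y, f (x + y) = f x + f y
  map_mul : ∀ x y, f (x * y) = f x * f y

/-- The direct product of a family of ai-semirings, with componentwise operations. -/
instance AISemiring.instPi {I : Type u} (S : I → Type u) [∀ i, AISemiring (S i)] :
    AISemiring (∀ i, S i) where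
  add x y := fun i => x i + y i
  mul x y := fun i => x i * y i
  add_assoc _ _ _ := funext fun _ => AISemiring.add_assoc _ _ _
  add_comm _ _ := funext fun _ => AISemiring.add_comm _ _
  add_idem _ := funext fun _ => AISemiring.add_idem _
  mul_assoc _ _ _ := funext fun _ => AISemiring.mul_assoc _ _ _
  add_mul _ _ _ := funext fun _ => AISemiring.add_mul _ _ _
  mul_add _ _ _ := funext fun _ => AISemiring.mul_add _ _ _

/-- The direct product of a family of algebras. -/
def AIAlg.pi {I : Type u} (A : I → AIAlg.{u}) : AIAlg.{u} := ⟨∀ i, A i⟩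

/-- A variety of ai-semirings: a class of algebras closed under subalgebras (up to isomorphism),
homomorphic images and arbitrary direct products. -/
@[ext]
structure AIVariety : Type (u + 1) where
  mem : Set AIAlg.{u}
  closed_sub : ∀ (A B : AIAlg.{u}) (f : B → A), IsAIHom f → Function.Injective f →
    A ∈ mem → B ∈ mem
  closed_quot : ∀ (A B : AIAlg.{u}) (f : A → B), IsAIHom f → Function.Surjective f →
    A ∈ mem → B ∈ mem
  closed_pi : ∀ (I : Type u) (A : I → AIAlg.{u}), (∀ i, A i ∈ mem) → AIAlg.pi A ∈ mem

/-- Varieties are ordered by inclusion. -/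
instance AIVariety.instPartialOrder : PartialOrder AIVariety.{u} where
  le V W := V.mem ⊆ W.mem
  le_refl _ := Set.Subset.refl _
  le_trans _ _ _ h k := Set.Subset.trans h k
  le_antisymm _ _ h k := AIVariety.ext (Set.Subset.antisymm h k)

/-- The variety `V(A)` generated by `A`, that is, the smallest variety containing `A`. -/
def AIVariety.generatedBy (A : AIAlg.{u}) : AIVariety.{u} where
  mem := {B | ∀ V : AIVariety.{u}, A ∈ V.mem → B ∈ V.mem}
  closed_sub _ _ f hf hi h V hV := V.closed_sub _ _ f hf hi (h V hV)
  closed_quot _ _ f hf hs h V hV := V.closed_quot _ _ f hf hs (h V hV)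
  closed_pi I B h V hV := V.closed_pi I B fun i => h i V hV

/-- Terms in the operations `+` and `*` over the variables `x₀, x₁, x₂, …`. -/
inductive AITerm : Type
  | var : ℕ → AITerm
  | add : AITerm → AITerm → AITerm
  | mul : AITerm → AITerm → AITerm

/-- The value of a term under an assignment of the variables. -/
def AITerm.eval {S : Type u} [AISemiring S] (v : ℕ → S) : AITerm → S
  | .var n => v n
  | .add s t => s.eval v + t.eval v
  | .mul s t => s.eval v * t.eval v

/-- The identity `s ≈ t` holds in `S`. -/
def SatisfiesIdentity (S : Type u) [AISemiring S] (s t : AITerm) : Prop :=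
  ∀ v : ℕ → S, s.eval v = t.eval v

theorem AITerm.eval_hom {S T : Type u} [AISemiring S] [AISemiring T] {f : S → T}
    (hf : IsAIHom f) (v : ℕ → S) (t : AITerm) : f (t.eval v) = t.eval (fun n => f (v n)) := by
  induction t with
  | var n => rfl
  | add s t hs ht => simp only [AITerm.eval, hf.map_add, hs, ht]
  | mul s t hs ht => simp only [AITerm.eval, hf.map_mul, hs, ht]

/-- The subvariety of `V` determined by the identity `s ≈ t`. -/
def AIVariety.determinedBy (V : AIVariety.{u}) (s t : AITerm) : AIVariety.{u} where
  mem := {A | A ∈ V.mem ∧ SatisfiesIdentity A s t}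
  closed_sub A B f hf hi h := by
    refine ⟨V.closed_sub A B f hf hi h.1, fun v => hi ?_⟩
    rw [AITerm.eval_hom hf, AITerm.eval_hom hf]
    exact h.2 _
  closed_quot A B f hf hs h := by
    refine ⟨V.closed_quot A B f hf hs h.1, fun v => ?_⟩
    obtain ⟨g, hg⟩ := hs.hasRightInverse
    have hv : v = fun n => f (g (v n)) := funext fun n => (hg (v n)).symm
    rw [hv, ← AITerm.eval_hom hf (fun n => g (v n)), ← AITerm.eval_hom hf (fun n => g (v n)), h.2]
  closed_pi I A h := by
    refine ⟨V.closed_pi I A fun i => (h i).1, fun v => ?_⟩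
    funext i
    have hp : IsAIHom (fun x : (∀ i, A i) => x i) := ⟨fun _ _ => rfl, fun _ _ => rfl⟩
    exact (AITerm.eval_hom hp v s).trans (((h i).2 _).trans (AITerm.eval_hom hp v t).symm)

/-- The underlying set `{∞, a, 1}` of the semiring `S₇`. -/
inductive S7 : Type u
  | infty : S7
  | a : S7
  | one : S7

/-- The operations of `S₇`: `x + y = ∞` for distinct `x, y`; `∞` is a multiplicative zero, `1` is a
multiplicative identity, and `a * a = ∞`. -/
instance S7.instAISemiring : AISemiring S7.{u} where
  add
    | .a, .a => .a
    | .one, .one => .one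
    | _, _ => .infty
  mul
    | .one, .one => .one
    | .one, .a => .a
    | .a, .one => .a
    | _, _ => .infty
  add_assoc x y z := by cases x <;> cases y <;> cases z <;> rfl
  add_comm x y := by cases x <;> cases y <;> rfl
  add_idem x := by cases x <;> rfl
  mul_assoc x y z := by cases x <;> cases y <;> cases z <;> rfl
  add_mul x y z := by cases x <;> cases y <;> cases z <;> rfl
  mul_add x y z := by cases x <;> cases y <;> cases z <;> rfl

/-- `S₇` as an algebra. -/
def algS7 : AIAlg.{u} :=
  haveI : Nonempty S7.{u} := ⟨.one⟩
  ⟨S7.{u}⟩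

/-- `u` is a nonempty subword of a word in `W`. Words of the free commutative semigroup over `α`
are nonempty finite multisets of letters; their product is the sum of multisets. -/
def IsSubword {α : Type u} (W : Set (Multiset α)) (u : Multiset α) : Prop :=
  u ≠ 0 ∧ ∃ w ∈ W, u ≤ w

/-- The underlying set of `S_c(W)`: a zero element `0`, together with the nonempty subwords of words
in `W`. -/
inductive Sc {α : Type u} (W : Set (Multiset α)) : Type u
  | zero : Sc W
  | word (u : Multiset α) (h : IsSubword W u) : Sc W

namespace Sc

variable {α : Type u} {W : Set (Multiset α)}

open scoped Classical in
/-- The element of `S_c(W)` given by a word: the word itself if it is a nonempty subword of a word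
in `W`, and the zero element otherwise. -/
noncomputable def ofWord (W : Set (Multiset α)) (u : Multiset α) : Sc W :=
  if h : IsSubword W u then word u h else zero

/-- The product of two subwords is their product in the free commutative semigroup if that is again
a subword, and zero otherwise. -/
noncomputable def mul : Sc W → Sc W → Sc W
  | word u _, word v _ => ofWord W (u + v)
  | _, _ => zero

open scoped Classical in
/-- The sum of two distinct elements is zero. -/
noncomputable def add (x y : Sc W) : Sc W := if x = y then x else zero

theorem ofWord_of {u : Multiset α} (h : IsSubword W u) : ofWord W u = word u h := dif_pos h

theorem ofWord_of_not {u : Multiset α} (h : ¬ IsSubword W u) : ofWord W u = zero := dif_neg h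

theorem zero_mul (x : Sc W) : mul zero x = zero := by cases x <;> rfl

theorem mul_zero (x : Sc W) : mul x zero = zero := by cases x <;> rfl

theorem word_mul_word {u v : Multiset α} (hu : IsSubword W u) (hv : IsSubword W v) :
    mul (word u hu) (word v hv) = ofWord W (u + v) := rfl

theorem mul_comm (x y : Sc W) : mul x y = mul y x := by
  cases x with
  | zero => rw [zero_mul, mul_zero]
  | word u hu =>
    cases y with
    | zero => rw [zero_mul, mul_zero]
    | word v hv => rw [word_mul_word, word_mul_word, _root_.add_comm]

theorem ofWord_mul_word {u v : Multiset α} (hu : u ≠ 0) (hv : IsSubword W v) :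
    mul (ofWord W u) (word v hv) = ofWord W (u + v) := by
  by_cases h : IsSubword W u
  · rw [ofWord_of h, word_mul_word]
  · rw [ofWord_of_not h, zero_mul, ofWord_of_not]
    rintro ⟨-, w, hw, hle⟩
    exact h ⟨hu, w, hw, le_trans (Multiset.le_add_right u v) hle⟩

theorem mul_assoc (x y z : Sc W) : mul (mul x y) z = mul x (mul y z) := by
  cases x with
  | zero => simp only [zero_mul]
  | word u hu =>
    cases y with
    | zero => simp only [zero_mul, mul_zero]
    | word v hv =>
      cases z with
      | zero => simp only [mul_zero]
      | word w hw =>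
        have h1 : u + v ≠ 0 := fun h => hu.1 (add_eq_zero.1 h).1
        have h2 : v + w ≠ 0 := fun h => hv.1 (add_eq_zero.1 h).1
        rw [word_mul_word, word_mul_word, ofWord_mul_word h1, mul_comm (word u hu),
          ofWord_mul_word h2]
        congr 1
        rw [_root_.add_comm _ u, _root_.add_assoc]

theorem add_self (x : Sc W) : add x x = x := if_pos rfl

theorem add_ne {x y : Sc W} (h : x ≠ y) : add x y = zero := if_neg h

theorem add_zero (x : Sc W) : add x zero = zero := by
  by_cases h : x = zero
  · rw [h, add_self]
  · exact add_ne h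

theorem add_comm (x y : Sc W) : add x y = add y x := by
  by_cases h : x = y
  · rw [h]
  · rw [add_ne h, add_ne (Ne.symm h)]

theorem zero_add (x : Sc W) : add zero x = zero := by rw [add_comm, add_zero]

theorem add_assoc (x y z : Sc W) : add (add x y) z = add x (add y z) := by
  by_cases h : x = y
  · subst h
    by_cases k : x = z
    · subst k; rw [add_self, add_self]
    · rw [add_self, add_ne k, add_zero]
  · rw [add_ne h, zero_add]
    by_cases k : y = z
    · subst k; rw [add_self, add_ne h]
    · rw [add_ne k, add_zero]

/-- The `0`-cancellation property. -/
theorem mul_cancel {x y z : Sc W} (h : mul x y = mul x z) (h0 : mul x y ≠ zero) : y = z := by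
  cases x with
  | zero => exact absurd (zero_mul _) h0
  | word u hu =>
    cases y with
    | zero => exact absurd (mul_zero _) h0
    | word v hv =>
      cases z with
      | zero => exact absurd (h.trans (mul_zero _)) h0
      | word w hw =>
        rw [word_mul_word] at h h0
        rw [word_mul_word] at h
        have h1 : IsSubword W (u + v) := by
          by_contra k; exact h0 (ofWord_of_not k)
        have h2 : IsSubword W (u + w) := by
          by_contra k; exact h0 (h.trans (ofWord_of_not k))
        rw [ofWord_of h1, ofWord_of h2] at h
        injection h with h3
        have h4 : v = w := add_left_cancel h3
        subst h4
        rfl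

theorem mul_add (x y z : Sc W) : mul x (add y z) = add (mul x y) (mul x z) := by
  by_cases h : y = z
  · subst h; rw [add_self, add_self]
  · rw [add_ne h, mul_zero]
    by_cases k : mul x y = mul x z
    · by_cases k0 : mul x y = zero
      · rw [← k, k0, add_self]
      · exact absurd (mul_cancel k k0) h
    · rw [add_ne k]

/-- The flat semiring `S_c(W)`. -/
noncomputable instance instAISemiring : AISemiring (Sc W) where
  add := add
  mul := mul
  add_assoc := add_assoc
  add_comm := add_comm
  add_idem := add_self
  mul_assoc := mul_assoc
  add_mul x y z := by
    change mul (add x y) z = add (mul x z) (mul y z)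
    rw [mul_comm, mul_add, mul_comm z x, mul_comm z y]
  mul_add := mul_add

instance instNonempty : Nonempty (Sc W) := ⟨zero⟩

end Sc

/-- The algebra `S_c(a₁⋯a_r)`, where `a₁, …, a_r` are distinct letters. -/
noncomputable def algScLinear (r : ℕ) : AIAlg.{u} :=
  ⟨Sc ({(Finset.univ : Finset (ULift.{u} (Fin r))).val} : Set (Multiset (ULift.{u} (Fin r))))⟩

/-- The variety `N`: the subvariety of `V(S₇)` determined by the identity `x²y ≈ x²`. -/
def varietyN : AIVariety.{u} :=
  (AIVariety.generatedBy algS7).determinedBy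
    (.mul (.mul (.var 0) (.var 0)) (.var 1)) (.mul (.var 0) (.var 0))

/-- The product `x_s x_{s+1} ⋯ x_{s+k-1}` of `k ≥ 1` consecutive variables
(by convention `x_s` if `k = 0`). -/
def AITerm.prodVars (s : ℕ) : ℕ → AITerm
  | 0 => .var s
  | 1 => .var s
  | k + 2 => .mul (AITerm.prodVars s (k + 1)) (.var (s + k + 1))

/-- For `k ≥ 1`, the variety `N_k`: the subvariety of `N` determined by the identity
`x₁⋯x_k ≈ y₁⋯y_k`, the variables `x₁, …, x_k, y₁, …, y_k` being distinct. -/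
def varietyNk (k : ℕ) : AIVariety.{u} :=
  varietyN.determinedBy (AITerm.prodVars 0 k) (AITerm.prodVars k k)

/-! The power set of `I` with a zero adjoined, where disjoint sets multiply to their union and
everything else collapses, is a quotient of a power of `S7`: a tuple without `∞` is recorded by the
set of its coordinates equal to `a`. A family of nonempty subsets of `I` generates a subalgebra in
which squares vanish. If nonzero products of generators have length at most `r`, this subalgebra
lies in the variety `N` with index `r + 1`, and the factors of a nonzero product of `r` elements are
all generators.

Write `r = s + 3`. A finite graph with an edge is encoded by the sum `t` of the words `x y z₀ ⋯
z_s`, one for each arc `(x, y)`, with fresh letters `z` for each arc. In the subalgebras above, the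
identity `t ≈ t²` says that `t` always takes the value zero. A nonzero value sends the non-isolated
vertices to generators, adjacent vertices to disjoint ones. Hence the identity holds whenever no
such assignment exists (`satisfies_graphTerm`). For `S_c(a₁⋯a_r)`, embedded through the singletons,
an assignment would be an `r`-coloring.

Each graph also has an algebra of its own. Its generators are, for a vertex, the independent sets
containing it; for an arc, the independent sets avoiding both ends; and `s` separate points. Those
used by the word of an arc partition the whole set, so all words of `t` take the same nonzero value
and the identity fails (`not_satisfies_graphTerm`). Vertex generators are disjoint only for adjacent
vertices and arc generators always meet, so in a triangle-free graph nonzero products have length at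
most `2 + 1 + s = r`.

It remains to choose graphs `G₀, G₁, …`, triangle-free and not `r`-colorable, such that the identity
of `Gᵢ` holds in the algebra of `Gₙ` for all `i ≠ n`. If `i > n`, an assignment would color `Gᵢ` by
the generators of the algebra of `Gₙ`, which are too few. If `i < n`, the vertices of `Gᵢ` sent to
vertex generators span a subgraph that maps to `Gₙ`; it is bipartite, since the odd closed walks of
`Gₙ` are too long, and one color for the arcs and `s` for the points complete an `r`-coloring.
Iterated line digraphs of transitive tournaments supply such graphs.

Imposing the identities with index outside `A` now embeds the power set of the natural numbers into
the interval. The bound from above is Birkhoff's theorem, as there are only countably many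
identities. -/

/-! ### Finite graphs of large chromatic number and large odd girth -/

/-- The arcs of the line digraph of `r`: two arcs of `r` are consecutive. -/
def lineRel {V : Type u} (r : V → V → Prop) (p q : {p : V × V // r p.1 p.2}) : Prop :=
  p.1.2 = q.1.1

/-- The source (`false`) or the target (`true`) of an arc. -/
def arcEnd {V : Type u} {r : V → V → Prop} (p : {p : V × V // r p.1 p.2}) : Bool → V
  | false => p.1.1
  | true => p.1.2

theorem adj_arcEnd {V : Type u} {r : V → V → Prop} {f : V → ℕ} (hf : ∀ u v, r u v → f u < f v)
    (p : {p : V × V // r p.1 p.2}) (i : Bool) :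
    (SimpleGraph.fromRel r).Adj (arcEnd p i) (arcEnd p !i) := by
  have h : p.1.1 ≠ p.1.2 := fun h => (hf _ _ p.2).ne (congrArg f h)
  rw [SimpleGraph.fromRel_adj]
  cases i
  · exact ⟨h, Or.inl p.2⟩
  · exact ⟨h.symm, Or.inr p.2⟩

/-- A step of a walk in the line digraph yields a walk of length at most one between end points
of the two arcs; the new end is the source after a forward step and the target after a backward
one. -/
theorem exists_walk_of_lineRel_adj {V : Type u} {r : V → V → Prop} {f : V → ℕ}
    (hf : ∀ u v, r u v → f u < f v) {a b : {p : V × V // r p.1 p.2}}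
    (h : (SimpleGraph.fromRel (lineRel r)).Adj a b) :
    ∃ q : Bool, ((q = false ∧ f a.1.1 < f b.1.1) ∨ (q = true ∧ f b.1.1 < f a.1.1)) ∧
      ∀ p : Bool, ∃ w : (SimpleGraph.fromRel r).Walk (arcEnd a p) (arcEnd b q),
        (p = q ∧ w.length = 1) ∨ (p = !q ∧ w.length = 0) := by
  rw [SimpleGraph.fromRel_adj] at h
  have key : ∀ q : Bool, arcEnd a (!q) = arcEnd b q →
      ∀ p : Bool, ∃ w : (SimpleGraph.fromRel r).Walk (arcEnd a p) (arcEnd b q),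
        (p = q ∧ w.length = 1) ∨ (p = !q ∧ w.length = 0) := by
    intro q hq p
    rw [← hq]
    by_cases hp : p = q
    · subst hp
      exact ⟨(adj_arcEnd hf a p).toWalk, Or.inl ⟨rfl, rfl⟩⟩
    · have hp' : p = !q := by revert hp; cases p <;> cases q <;> simp
      subst hp'
      exact ⟨.nil, Or.inr ⟨rfl, rfl⟩⟩
  rcases h.2 with h | h
  · refine ⟨false, Or.inl ⟨rfl, ?_⟩, key _ h⟩
    have : a.1.2 = b.1.1 := h
    rw [← this]
    exact hf _ _ a.2
  · refine ⟨true, Or.inr ⟨rfl, ?_⟩, key _ h.symm⟩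
    have : b.1.2 = a.1.1 := h
    rw [← this]
    exact hf _ _ b.2

/-- The one-step walks are concatenated. The end `q` does not depend on `p`, which is what lets the
induction compose. No length is lost only if every step goes in the same direction, and then `f`
changes strictly monotonically along the walk. -/
theorem exists_walk_of_lineRel_walk {V : Type u} {r : V → V → Prop} {f : V → ℕ}
    (hf : ∀ u v, r u v → f u < f v) {a b : {p : V × V // r p.1 p.2}}
    (w : (SimpleGraph.fromRel (lineRel r)).Walk a b) :
    (w.length = 0 ∧ a = b) ∨ ∃ q : Bool, ∀ p : Bool,
      ∃ w' : (SimpleGraph.fromRel r).Walk (arcEnd a p) (arcEnd b q),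
        w'.length ≤ w.length ∧ Even (w'.length + w.length + p.toNat + q.toNat) ∧
        (w'.length = w.length →
          (p = false ∧ f a.1.1 < f b.1.1) ∨ (p = true ∧ f b.1.1 < f a.1.1)) := by
  induction w with
  | nil => exact Or.inl ⟨rfl, rfl⟩
  | @cons a c b h w ih =>
    right
    obtain ⟨q, hq, hw⟩ := exists_walk_of_lineRel_adj hf h
    rcases ih with ⟨h0, rfl⟩ | ⟨q', ih⟩
    · refine ⟨q, fun p => ?_⟩
      obtain ⟨w', hw'⟩ := hw p
      refine ⟨w', ?_⟩
      rw [SimpleGraph.Walk.length_cons, h0]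
      rcases hw' with ⟨rfl, h1⟩ | ⟨rfl, h1⟩
      · rw [h1]
        exact ⟨le_rfl, by cases p <;> decide, fun _ => hq⟩
      · rw [h1]
        exact ⟨by omega, by cases q <;> decide, fun h => by omega⟩
    · refine ⟨q', fun p => ?_⟩
      obtain ⟨w', hw'⟩ := hw p
      obtain ⟨w'', h1, h2, h3⟩ := ih q
      refine ⟨w'.append w'', ?_⟩
      rw [SimpleGraph.Walk.length_cons, SimpleGraph.Walk.length_append]
      rcases hw' with ⟨rfl, hl⟩ | ⟨rfl, hl⟩
      · rw [hl]
        refine ⟨by omega, ?_, fun h => ?_⟩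
        · rw [Nat.even_iff] at h2 ⊢
          omega
        · rcases h3 (by omega) with ⟨rfl, h4⟩ | ⟨rfl, h4⟩
          · exact Or.inl ⟨rfl, by simp at hq; omega⟩
          · exact Or.inr ⟨rfl, by simp at hq; omega⟩
      · rw [hl]
        refine ⟨by omega, ?_, fun h => by omega⟩
        rw [Nat.even_iff] at h2 ⊢
        cases q <;> simp at h2 ⊢ <;> omega

/-- Taking `p = q` closes the projected walk and preserves parity. Equal length would give `f a.1.1
< f a.1.1`, so at least two steps are lost. -/
theorem exists_shorter_odd_closed_walk {V : Type u} {r : V → V → Prop} {f : V → ℕ}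
    (hf : ∀ u v, r u v → f u < f v) {a : {p : V × V // r p.1 p.2}}
    (w : (SimpleGraph.fromRel (lineRel r)).Walk a a) (hw : Odd w.length) :
    ∃ (x : V) (w' : (SimpleGraph.fromRel r).Walk x x), Odd w'.length ∧
      w'.length + 2 ≤ w.length := by
  rcases exists_walk_of_lineRel_walk hf w with ⟨h0, -⟩ | ⟨q, h⟩
  · rw [h0] at hw
    exact absurd hw (by decide)
  · obtain ⟨w', h1, h2, h3⟩ := h q
    have h4 : w'.length ≠ w.length := fun h => by
      rcases h3 h with h | h
      · exact lt_irrefl _ h.2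
      · exact lt_irrefl _ h.2
    refine ⟨_, w', ?_⟩
    rw [Nat.odd_iff] at hw ⊢
    rw [Nat.even_iff] at h2
    omega

/-- Color a vertex by the set of colors of its outgoing arcs. For an arc from `u` to `v`, the color
of that arc belongs to the set of `u` but not to that of `v`, because every arc leaving `v` is
adjacent to it in the line digraph. -/
theorem colorable_of_lineRel_colorable {V : Type u} {r : V → V → Prop} {c : ℕ}
    (h : (SimpleGraph.fromRel (lineRel r)).Colorable c) :
    (SimpleGraph.fromRel r).Colorable (2 ^ c) := by
  classical
  obtain ⟨C⟩ := h
  have key : ∀ u v, u ≠ v → r u v →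
      (Finset.univ.filter fun i => ∃ p : {p : V × V // r p.1 p.2}, p.1.1 = u ∧ C p = i) ≠
      (Finset.univ.filter fun i => ∃ p : {p : V × V // r p.1 p.2}, p.1.1 = v ∧ C p = i) := by
    intro u v huv h he
    have h1 : C ⟨(u, v), h⟩ ∈
        Finset.univ.filter fun i => ∃ p : {p : V × V // r p.1 p.2}, p.1.1 = v ∧ C p = i := by
      rw [← he]
      exact Finset.mem_filter.2 ⟨Finset.mem_univ _, _, rfl, rfl⟩
    obtain ⟨-, p, hp, hc⟩ := Finset.mem_filter.1 h1
    refine C.valid (v := ⟨(u, v), h⟩) (w := p) ?_ hc.symm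
    rw [SimpleGraph.fromRel_adj]
    refine ⟨fun h => huv ?_, Or.inl hp.symm⟩
    rw [← hp, ← h]
  have := (SimpleGraph.Coloring.mk (G := SimpleGraph.fromRel r)
    (fun u => Finset.univ.filter fun i => ∃ p : {p : V × V // r p.1 p.2}, p.1.1 = u ∧ C p = i)
    (fun {u v} h => by
      rw [SimpleGraph.fromRel_adj] at h
      rcases h.2 with h' | h'
      · exact key _ _ h.1 h'
      · exact (key _ _ h.1.symm h').symm)).colorable
  simpa using this

theorem exists_digraph_not_colorable_oddGirth (k : ℕ) : ∀ c : ℕ, ∃ (V : Type u) (_ : Finite V)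
    (r : V → V → Prop) (f : V → ℕ), (∀ u v, r u v → f u < f v) ∧
      ¬ (SimpleGraph.fromRel r).Colorable c ∧
      ∀ u (w : (SimpleGraph.fromRel r).Walk u u), Odd w.length → 2 * k + 1 ≤ w.length := by
  induction k with
  | zero =>
    intro c
    -- The transitive tournament on `c + 1` vertices; the girth condition only asks for length at
    -- least one here.
    refine ⟨ULift (Fin (c + 1)), inferInstance, fun u v => u.down < v.down, fun u => u.down,
      fun u v h => h, ?_, fun u w h => by have := h.pos; omega⟩
    rintro ⟨C⟩
    have hC : Function.Injective C := by
      intro u v h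
      by_contra huv
      refine C.valid ?_ h
      rw [SimpleGraph.fromRel_adj]
      exact ⟨huv, lt_or_gt_of_ne fun h => huv (ULift.down_injective h)⟩
    have := Fintype.card_le_of_injective C hC
    simp at this
  | succ k ih =>
    intro c
    -- Passing to the line digraph may reduce the chromatic number to its logarithm.
    obtain ⟨V, hV, r, f, hf, hc, hw⟩ := ih (2 ^ c)
    refine ⟨{p : V × V // r p.1 p.2}, inferInstance, lineRel r, fun p => f p.1.1, ?_,
      fun h => hc (colorable_of_lineRel_colorable h), fun a w h => ?_⟩
    · intro p q h
      have h : p.1.2 = q.1.1 := h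
      change f p.1.1 < f q.1.1
      rw [← h]
      exact hf _ _ p.2
    · obtain ⟨x, w', h1, h2⟩ := exists_shorter_odd_closed_walk hf w h
      have := hw x w' h1
      omega

theorem exists_graph_not_colorable_oddGirth (b : ℕ) : ∃ (V : Type u) (_ : Finite V)
    (G : SimpleGraph V), ¬ G.Colorable b ∧ ∀ u (w : G.Walk u u), Odd w.length → b < w.length := by
  obtain ⟨V, hV, r, f, -, hc, hw⟩ := exists_digraph_not_colorable_oddGirth.{u} b b
  exact ⟨V, hV, _, hc, fun u w h => by have := hw u w h; omega⟩

/-- A finite graph has finitely many induced subgraphs, and each non-bipartite one contains an odd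
closed walk. -/
theorem exists_bound_odd_closed_walk {V : Type u} [Finite V] (G : SimpleGraph V) :
    ∃ L : ℕ, ∀ S : Set V, ¬ (G.induce S).Colorable 2 →
      ∃ (x : S) (w : (G.induce S).Walk x x), Odd w.length ∧ w.length ≤ L := by
  have h : ∀ S : Set V, ∃ L : ℕ, ¬ (G.induce S).Colorable 2 →
      ∃ (x : S) (w : (G.induce S).Walk x x), Odd w.length ∧ w.length ≤ L := by
    intro S
    by_cases hS : (G.induce S).Colorable 2
    · exact ⟨0, fun h => absurd hS h⟩
    · have h := hS
      rw [SimpleGraph.two_colorable_iff_forall_loop_even] at h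
      push Not at h
      obtain ⟨x, w, hw⟩ := h
      exact ⟨w.length, fun _ => ⟨x, w, by simpa using hw, le_rfl⟩⟩
  choose L hL using h
  obtain ⟨M, hM⟩ := (Set.finite_range L).bddAbove
  refine ⟨M, fun S hS => ?_⟩
  obtain ⟨x, w, h1, h2⟩ := hL S hS
  exact ⟨x, w, h1, h2.trans (hM ⟨S, rfl⟩)⟩

/-- A sequence of finite triangle-free graphs, none of them `r`-colorable, such that every later
graph has chromatic number above a given bound `B` depending on the earlier ones, and receives
homomorphisms only from the bipartite induced subgraphs of the earlier ones. -/
theorem exists_seq_graphs (r : ℕ) (hr : 2 < r)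
    (B : ∀ V : Type u, SimpleGraph V → ℕ) :
    ∃ (V : ℕ → Type u) (_ : ∀ n, Finite (V n)) (G : ∀ n, SimpleGraph (V n)),
      (∀ n, ¬ (G n).Colorable r) ∧
      (∀ n x y z, (G n).Adj x y → (G n).Adj y z → ¬ (G n).Adj z x) ∧
      (∀ i n, i < n → ¬ (G n).Colorable (B (V i) (G i))) ∧
      (∀ i n, i < n → ∀ S : Set (V i), Nonempty ((G i).induce S →g G n) →
        ((G i).induce S).Colorable 2) := by
  choose V hV G hc hw using exists_graph_not_colorable_oddGirth.{u}
  choose L hL using fun b => exists_bound_odd_closed_walk (G b)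
  -- The parameter `b` bounds both the chromatic number and the odd girth of `G b` from below. The
  -- next one must exceed neither bound's need: `L b` for the odd walks of `G b`, and `B` for its
  -- coloring bound.
  let next : ℕ → ℕ := fun b => max b (max (L b) (B (V b) (G b)))
  let s : ℕ → ℕ := fun n => next^[n] r
  have hs : ∀ n, s (n + 1) = next (s n) := fun n => Function.iterate_succ_apply' _ _ _
  have hmono : Monotone s := monotone_nat_of_le_succ fun n => by
    rw [hs]; exact le_max_left _ _
  have hrs : ∀ n, r ≤ s n := fun n => hmono (Nat.zero_le n)
  have hnext : ∀ i n, i < n → next (s i) ≤ s n := fun i n h => by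
    rw [← hs]; exact hmono h
  refine ⟨fun n => V (s n), fun n => hV _, fun n => G (s n), fun n h => hc _ (h.mono (hrs n)),
    fun n x y z h1 h2 h3 => ?_, fun i n h hcol => hc _ (hcol.mono ?_), fun i n h S hS => ?_⟩
  · have h4 := hw (s n) x (.cons h1 (.cons h2 (.cons h3 .nil))) (by simp; decide)
    have := hrs n
    simp at h4
    omega
  · exact le_trans (le_trans (le_max_right _ _) (le_max_right _ _)) (hnext i n h)
  · by_contra hcol
    obtain ⟨x, w, h1, h2⟩ := hL (s i) S hcol
    obtain ⟨g⟩ := hS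
    have h3 := hw (s n) _ (w.map g) (by rwa [SimpleGraph.Walk.length_map])
    rw [SimpleGraph.Walk.length_map] at h3
    have h4 : L (s i) ≤ s n :=
      le_trans (le_trans (le_max_left _ _) (le_max_right _ _)) (hnext i n h)
    omega

/-! ### Birkhoff's theorem: a variety is determined by its identities -/

/-- The subalgebra of `A` on the set of elements satisfying `p`. -/
def AIAlg.sub (A : AIAlg.{u}) (p : A → Prop) (hadd : ∀ x y, p x → p y → p (x + y))
    (hmul : ∀ x y, p x → p y → p (x * y)) (hne : ∃ x, p x) : AIAlg.{u} :=
  letI : AISemiring {x : A // p x} :=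
    { add := fun x y => ⟨x.1 + y.1, hadd _ _ x.2 y.2⟩
      mul := fun x y => ⟨x.1 * y.1, hmul _ _ x.2 y.2⟩
      add_assoc := fun _ _ _ => Subtype.ext (AISemiring.add_assoc _ _ _)
      add_comm := fun _ _ => Subtype.ext (AISemiring.add_comm _ _)
      add_idem := fun _ => Subtype.ext (AISemiring.add_idem _)
      mul_assoc := fun _ _ _ => Subtype.ext (AISemiring.mul_assoc _ _ _)
      add_mul := fun _ _ _ => Subtype.ext (AISemiring.add_mul _ _ _)
      mul_add := fun _ _ _ => Subtype.ext (AISemiring.mul_add _ _ _) }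
  haveI : Nonempty {x : A // p x} := let ⟨x, hx⟩ := hne; ⟨⟨x, hx⟩⟩
  ⟨{x : A // p x}⟩

/-- The inclusion of a subalgebra. -/
def AIAlg.sub.val {A : AIAlg.{u}} {p : A → Prop} {hadd : ∀ x y, p x → p y → p (x + y)}
    {hmul : ∀ x y, p x → p y → p (x * y)} {hne : ∃ x, p x} (x : A.sub p hadd hmul hne) : A :=
  Subtype.val (p := p) x

section sub

variable {A : AIAlg.{u}} {p : A → Prop} {hadd : ∀ x y, p x → p y → p (x + y)}
  {hmul : ∀ x y, p x → p y → p (x * y)} {hne : ∃ x, p x}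

theorem AIAlg.sub.isAIHom_val : IsAIHom (AIAlg.sub.val : A.sub p hadd hmul hne → A) :=
  ⟨fun _ _ => rfl, fun _ _ => rfl⟩

theorem AIAlg.sub.val_injective :
    Function.Injective (AIAlg.sub.val : A.sub p hadd hmul hne → A) :=
  Subtype.val_injective

theorem AIAlg.sub.property (x : A.sub p hadd hmul hne) : p x.val := Subtype.property (p := p) x

theorem AIAlg.sub.exists_val_eq {a : A} (h : p a) : ∃ x : A.sub p hadd hmul hne, x.val = a :=
  ⟨(⟨a, h⟩ : {x : A // p x}), rfl⟩

theorem AIVariety.sub_mem {V : AIVariety.{u}} (hA : A ∈ V.mem) : A.sub p hadd hmul hne ∈ V.mem :=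
  V.closed_sub _ _ _ AIAlg.sub.isAIHom_val AIAlg.sub.val_injective hA

end sub

/-- Terms in the operations `+` and `*` over the variables `X`. -/
inductive VTerm (X : Type u) : Type u
  | var : X → VTerm X
  | add : VTerm X → VTerm X → VTerm X
  | mul : VTerm X → VTerm X → VTerm X

namespace VTerm

variable {X : Type u}

/-- The value of a term under an assignment of the variables. -/
def eval {S : Type u} [AISemiring S] (v : X → S) : VTerm X → S
  | .var n => v n
  | .add s t => s.eval v + t.eval v
  | .mul s t => s.eval v * t.eval v

/-- Numbering of the variables of a term. -/
def toAITerm (e : X → ℕ) : VTerm X → AITerm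
  | .var x => .var (e x)
  | .add s t => .add (s.toAITerm e) (t.toAITerm e)
  | .mul s t => .mul (s.toAITerm e) (t.toAITerm e)

/-- The variables occurring in a term. -/
def vars : VTerm X → Set X
  | .var x => {x}
  | .add s t => s.vars ∪ t.vars
  | .mul s t => s.vars ∪ t.vars

theorem finite_vars (t : VTerm X) : t.vars.Finite := by
  induction t with
  | var x => exact Set.finite_singleton x
  | add s t hs ht => exact hs.union ht
  | mul s t hs ht => exact hs.union ht

theorem eval_hom {S T : Type u} [AISemiring S] [AISemiring T] {f : S → T}
    (hf : IsAIHom f) (v : X → S) (t : VTerm X) : f (t.eval v) = t.eval (fun n => f (v n)) := by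
  induction t with
  | var n => rfl
  | add s t hs ht => simp only [eval, hf.map_add, hs, ht]
  | mul s t hs ht => simp only [eval, hf.map_mul, hs, ht]

theorem eval_congr {S : Type u} [AISemiring S] {v w : X → S} {t : VTerm X}
    (h : ∀ x ∈ t.vars, v x = w x) : t.eval v = t.eval w := by
  induction t with
  | var n => exact h n rfl
  | add s t hs ht =>
    rw [eval, eval, hs fun x hx => h x (Or.inl hx), ht fun x hx => h x (Or.inr hx)]
  | mul s t hs ht =>
    rw [eval, eval, hs fun x hx => h x (Or.inl hx), ht fun x hx => h x (Or.inr hx)]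

theorem eval_toAITerm {S : Type u} [AISemiring S] (e : X → ℕ) (v : ℕ → S) (t : VTerm X) :
    (t.toAITerm e).eval v = t.eval fun x => v (e x) := by
  induction t with
  | var n => rfl
  | add s t hs ht => rw [toAITerm, AITerm.eval, eval, hs, ht]
  | mul s t hs ht => rw [toAITerm, AITerm.eval, eval, hs, ht]

/-- An identity can be tested on assignments of numbered variables. -/
theorem exists_numbering [Nonempty X] (s t : VTerm X) : ∃ e : X → ℕ, ∃ d : ℕ → X,
    ∀ (S : Type u) [AISemiring S] (v : X → S),
      (s.toAITerm e).eval (fun n => v (d n)) = s.eval v ∧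
      (t.toAITerm e).eval (fun n => v (d n)) = t.eval v := by
  obtain ⟨e, he⟩ := Set.countable_iff_exists_injOn.1 (s.finite_vars.union t.finite_vars).countable
  refine ⟨e, Function.invFunOn e (s.vars ∪ t.vars), fun S _ v => ?_⟩
  have h : ∀ x ∈ s.vars ∪ t.vars, Function.invFunOn e (s.vars ∪ t.vars) (e x) = x :=
    fun x hx => he.leftInvOn_invFunOn hx
  rw [eval_toAITerm, eval_toAITerm]
  exact ⟨eval_congr fun x hx => by rw [h x (Or.inl hx)],
    eval_congr fun x hx => by rw [h x (Or.inr hx)]⟩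

end VTerm

/-- The identities of a variety. -/
def AIVariety.identities (V : AIVariety.{u}) : Set (AITerm × AITerm) :=
  {p | ∀ A ∈ V.mem, SatisfiesIdentity A p.1 p.2}

/-- Birkhoff's theorem. -/
theorem AIVariety.mem_of_identities {V : AIVariety.{u}} {B : AIAlg.{u}}
    (hB : ∀ p ∈ V.identities, SatisfiesIdentity B p.1 p.2) : B ∈ V.mem := by
  have hnum : ∀ s t : VTerm B, (∀ A ∈ V.mem, ∀ v : B → A, s.eval v = t.eval v) →
      s.eval (id : B → B) = t.eval id := by
    intro s t h
    obtain ⟨e, d, hed⟩ := VTerm.exists_numbering s t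
    have h1 := hB (s.toAITerm e, t.toAITerm e) (fun A hA v => by
      rw [VTerm.eval_toAITerm, VTerm.eval_toAITerm]
      exact h A hA _) (fun n => d n)
    have h2 := hed B id
    exact (h2.1.symm.trans h1).trans h2.2
  -- One coordinate for each pair of terms separated by some algebra of `V`; indexing by pairs of
  -- terms keeps the product small.
  let I : Type u := {p : VTerm B × VTerm B // ∃ A ∈ V.mem, ∃ v : B → A, p.1.eval v ≠ p.2.eval v}
  choose A hA v hv using fun i : I => i.2
  let ev : VTerm B → AIAlg.pi A := fun t => t.eval fun x i => v i x
  have hev : ∀ t i, ev t i = t.eval (v i) := fun t i =>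
    VTerm.eval_hom (f := fun x : (∀ i, A i) => x i) ⟨fun _ _ => rfl, fun _ _ => rfl⟩ _ t
  have hid : ∀ s t, ev s = ev t → s.eval (id : B → B) = t.eval id := by
    intro s t hst
    apply hnum
    by_contra! h
    let i : I := ⟨(s, t), h⟩
    refine hv i ?_
    have := congrFun hst i
    rwa [hev, hev] at this
  -- The algebra of `V` freely generated by the elements of `B`, realized by term functions;
  -- evaluating terms in `B` is well defined on it by `hid`.
  let R : AIAlg.{u} := (AIAlg.pi A).sub (fun x => ∃ t, ev t = x)
    (by rintro _ _ ⟨s, rfl⟩ ⟨t, rfl⟩; exact ⟨.add s t, rfl⟩)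
    (by rintro _ _ ⟨s, rfl⟩ ⟨t, rfl⟩; exact ⟨.mul s t, rfl⟩)
    ⟨_, .var (Classical.arbitrary B), rfl⟩
  have hR : R ∈ V.mem := AIVariety.sub_mem (V.closed_pi I A hA)
  choose g hg using fun x : R => AIAlg.sub.property x
  refine V.closed_quot R B (fun x => (g x).eval id) ⟨fun x y => ?_, fun x y => ?_⟩ (fun b => ?_) hR
  · refine hid (g (x + y)) (.add (g x) (g y)) ?_
    rw [hg]
    exact (congrArg₂ (fun a b : AIAlg.pi A => a + b) (hg x) (hg y)).symm
  · refine hid (g (x * y)) (.mul (g x) (g y)) ?_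
    rw [hg]
    exact (congrArg₂ (fun a b : AIAlg.pi A => a * b) (hg x) (hg y)).symm
  · obtain ⟨x, hx⟩ : ∃ x : R, x.val = ev (.var b) := AIAlg.sub.exists_val_eq ⟨_, rfl⟩
    exact ⟨x, hid (g x) (.var b) ((hg x).trans hx)⟩

theorem AIVariety.identities_injective : Function.Injective AIVariety.identities.{u} := by
  have h : ∀ V W : AIVariety.{u}, V.identities = W.identities → V ≤ W := by
    intro V W h A hA
    refine AIVariety.mem_of_identities fun p hp => ?_
    rw [← h] at hp
    exact hp A hA
  exact fun V W hVW => le_antisymm (h V W hVW) (h W V hVW.symm)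

/-! ### Countability of identities and the upper bound on the number of varieties -/

/-- A coding of terms by lists of numbers. -/
def AITerm.code : AITerm → List ℕ
  | .var n => [2, n]
  | .add s t => 0 :: s.code.length :: (s.code ++ t.code)
  | .mul s t => 1 :: s.code.length :: (s.code ++ t.code)

theorem AITerm.code_injective : Function.Injective AITerm.code := by
  intro s
  induction s with
  | var n => intro t h; cases t <;> simp_all [AITerm.code]
  | add s₁ s₂ h₁ h₂ =>
    intro t h
    cases t with
    | add t₁ t₂ =>
      simp only [AITerm.code, List.cons.injEq, true_and] at h
      obtain ⟨h3, h4⟩ := List.append_inj h.2 h.1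
      rw [h₁ h3, h₂ h4]
    | var n => simp [AITerm.code] at h
    | mul t₁ t₂ => simp [AITerm.code] at h
  | mul s₁ s₂ h₁ h₂ =>
    intro t h
    cases t with
    | mul t₁ t₂ =>
      simp only [AITerm.code, List.cons.injEq, true_and] at h
      obtain ⟨h3, h4⟩ := List.append_inj h.2 h.1
      rw [h₁ h3, h₂ h4]
    | var n => simp [AITerm.code] at h
    | add t₁ t₂ => simp [AITerm.code] at h

theorem AIVariety.mk_le_continuum (C : Set AIVariety.{u}) : Cardinal.mk C ≤ Cardinal.continuum := by
  have : Countable AITerm := AITerm.code_injective.countable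
  have h1 := Cardinal.lift_mk_le_lift_mk_of_injective
    (AIVariety.identities_injective.{u}.comp (Subtype.val_injective (p := (· ∈ C))))
  have h2 : Cardinal.mk (Set (AITerm × AITerm)) ≤ Cardinal.continuum := by
    rw [Cardinal.mk_set, ← Cardinal.two_power_aleph0]
    exact Cardinal.power_le_power_left two_ne_zero Cardinal.mk_le_aleph0
  have h3 := h1.trans (Cardinal.lift_le.2 h2)
  rw [Cardinal.lift_continuum] at h3
  simpa using h3

/-! ### Flat semirings of sets -/

/-- The flat semiring of all subsets of `I`, with a zero adjoined: the product of disjoint sets is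
their union, all other products and all sums of distinct elements are zero. -/
def SetFlat (I : Type u) : Type u := Option (Set I)

namespace SetFlat

variable {I : Type u}

/-- The zero element. -/
def zero : SetFlat I := Option.none

/-- The element given by a set. -/
def of (X : Set I) : SetFlat I := Option.some X

theorem of_injective : Function.Injective (of : Set I → SetFlat I) := Option.some_injective _

theorem of_ne_zero (X : Set I) : of X ≠ zero := Option.some_ne_none _

theorem eq_zero_or_of (x : SetFlat I) : x = zero ∨ ∃ X, x = of X := by
  cases x
  · exact Or.inl rfl
  · exact Or.inr ⟨_, rfl⟩

open scoped Classical in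
/-- The product. -/
noncomputable def mul : SetFlat I → SetFlat I → SetFlat I
  | Option.some X, Option.some Y => if Disjoint X Y then of (X ∪ Y) else zero
  | _, _ => zero

theorem mul_of_disjoint {X Y : Set I} (h : Disjoint X Y) : mul (of X) (of Y) = of (X ∪ Y) :=
  if_pos h

theorem mul_of_not_disjoint {X Y : Set I} (h : ¬ Disjoint X Y) : mul (of X) (of Y) = zero :=
  if_neg h

theorem zero_mul' (x : SetFlat I) : mul zero x = zero := by cases x <;> rfl

theorem mul_zero' (x : SetFlat I) : mul x zero = zero := by cases x <;> rfl

theorem mul_comm' (x y : SetFlat I) : mul x y = mul y x := by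
  rcases eq_zero_or_of x with rfl | ⟨X, rfl⟩
  · rw [zero_mul', mul_zero']
  rcases eq_zero_or_of y with rfl | ⟨Y, rfl⟩
  · rw [zero_mul', mul_zero']
  by_cases h : Disjoint X Y
  · rw [mul_of_disjoint h, mul_of_disjoint h.symm, Set.union_comm]
  · rw [mul_of_not_disjoint h, mul_of_not_disjoint fun h' => h h'.symm]

theorem mul_assoc' (x y z : SetFlat I) : mul (mul x y) z = mul x (mul y z) := by
  rcases eq_zero_or_of x with rfl | ⟨X, rfl⟩
  · simp only [zero_mul']
  rcases eq_zero_or_of y with rfl | ⟨Y, rfl⟩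
  · simp only [zero_mul', mul_zero']
  rcases eq_zero_or_of z with rfl | ⟨Z, rfl⟩
  · simp only [mul_zero']
  by_cases h : Disjoint X Y <;> by_cases k : Disjoint Y Z
  · rw [mul_of_disjoint h, mul_of_disjoint k]
    by_cases l : Disjoint X Z
    · rw [mul_of_disjoint (Set.disjoint_union_left.2 ⟨l, k⟩),
        mul_of_disjoint (Set.disjoint_union_right.2 ⟨h, l⟩), Set.union_assoc]
    · rw [mul_of_not_disjoint fun h' => l (Set.disjoint_union_left.1 h').1,
        mul_of_not_disjoint fun h' => l (Set.disjoint_union_right.1 h').2]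
  · rw [mul_of_disjoint h, mul_of_not_disjoint k, mul_zero',
      mul_of_not_disjoint fun h' => k (Set.disjoint_union_left.1 h').2]
  · rw [mul_of_not_disjoint h, mul_of_disjoint k, zero_mul',
      mul_of_not_disjoint fun h' => h (Set.disjoint_union_right.1 h').1]
  · rw [mul_of_not_disjoint h, mul_of_not_disjoint k, mul_zero', zero_mul']

/-- This 0-cancellation is exactly what makes multiplication distribute over the flat addition. -/
theorem mul_cancel {x y z : SetFlat I} (h : mul x y = mul x z) (h0 : mul x y ≠ zero) : y = z := by
  rcases eq_zero_or_of x with rfl | ⟨X, rfl⟩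
  · exact absurd (zero_mul' _) h0
  rcases eq_zero_or_of y with rfl | ⟨Y, rfl⟩
  · exact absurd (mul_zero' _) h0
  rcases eq_zero_or_of z with rfl | ⟨Z, rfl⟩
  · exact absurd (h.trans (mul_zero' _)) h0
  have hY : Disjoint X Y := by
    by_contra k
    exact h0 (mul_of_not_disjoint k)
  have hZ : Disjoint X Z := by
    by_contra k
    exact h0 (h.trans (mul_of_not_disjoint k))
  rw [mul_of_disjoint hY, mul_of_disjoint hZ] at h
  have h1 := of_injective h
  rw [← hY.symm.sdiff_eq_left, ← hZ.symm.sdiff_eq_left, ← Set.union_sdiff_left, h1,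
    Set.union_sdiff_left]

/-- The unit `of ∅` serves to write list and multiset products; the subalgebras used later,
generated by nonempty sets, do not contain it. -/
noncomputable instance instCommMonoid : CommMonoid (SetFlat I) where
  one := of ∅
  mul := mul
  mul_assoc := mul_assoc'
  one_mul x := by
    rcases eq_zero_or_of x with rfl | ⟨X, rfl⟩
    · rfl
    · exact (mul_of_disjoint (Set.empty_disjoint _)).trans (by rw [Set.empty_union])
  mul_one x := by
    rcases eq_zero_or_of x with rfl | ⟨X, rfl⟩
    · rfl
    · exact (mul_of_disjoint (Set.disjoint_empty _)).trans (by rw [Set.union_empty])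
  mul_comm := mul_comm'

open scoped Classical in
noncomputable instance instAISemiring : AISemiring (SetFlat I) where
  add x y := if x = y then x else zero
  mul := (· * ·)
  add_assoc x y z := by
    change (if (if x = y then x else zero) = z then (if x = y then x else zero) else zero) =
      if x = (if y = z then y else zero) then x else zero
    grind
  add_comm x y := by
    change (if x = y then x else zero) = if y = x then y else zero
    grind
  add_idem x := if_pos rfl
  mul_assoc := mul_assoc
  add_mul x y z := by
    change mul (if x = y then x else zero) z =
      if mul x z = mul y z then mul x z else zero
    have h1 := zero_mul' z
    have h2 := @mul_cancel _ z x y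
    rw [mul_comm' z x, mul_comm' z y] at h2
    grind
  mul_add z x y := by
    change mul z (if x = y then x else zero) =
      if mul z x = mul z y then mul z x else zero
    have h1 := mul_zero' z
    have h2 := @mul_cancel _ z x y
    grind

instance instNonempty : Nonempty (SetFlat I) := ⟨zero⟩

theorem zero_mul (x : SetFlat I) : zero * x = zero := zero_mul' x

theorem mul_zero (x : SetFlat I) : x * zero = zero := mul_zero' x

theorem of_mul_of {X Y : Set I} (h : Disjoint X Y) : of X * of Y = of (X ∪ Y) :=
  mul_of_disjoint h

theorem disjoint_of_mul_ne_zero {X Y : Set I} (h : of X * of Y ≠ zero) : Disjoint X Y := by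
  by_contra k
  exact h (mul_of_not_disjoint k)

theorem of_mul_self {X : Set I} (h : X.Nonempty) : of X * of X = zero := by
  by_contra k
  exact h.ne_empty (disjoint_self.1 (disjoint_of_mul_ne_zero k))

theorem left_ne_zero {x y : SetFlat I} (h : x * y ≠ zero) : x ≠ zero := fun k =>
  h (by rw [k, zero_mul])

theorem right_ne_zero {x y : SetFlat I} (h : x * y ≠ zero) : y ≠ zero := fun k =>
  h (by rw [k, mul_zero])

theorem add_of_ne {x y : SetFlat I} (h : x ≠ y) : x + y = zero := if_neg h

theorem add_self (x : SetFlat I) : x + x = x := if_pos rfl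

theorem add_eq_zero_or (x y : SetFlat I) : x + y = zero ∨ x + y = x ∧ x = y := by
  by_cases h : x = y
  · exact Or.inr ⟨by rw [← h, add_self], h⟩
  · exact Or.inl (add_of_ne h)

theorem prod_map_of {L : List (Set I)} (h : L.Pairwise Disjoint) :
    (L.map of).prod = of {i | ∃ X ∈ L, i ∈ X} := by
  induction L with
  | nil =>
    change of ∅ = _
    congr 1
    ext i
    simp
  | cons X L ih =>
    rw [List.pairwise_cons] at h
    rw [List.map_cons, List.prod_cons, ih h.2, of_mul_of]
    · congr 1
      ext i
      simp
    · rw [Set.disjoint_left]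
      rintro i hi ⟨Y, hY, hi'⟩
      exact Set.disjoint_left.1 (h.1 Y hY) hi hi'

end SetFlat

/-- The flat semiring of all subsets of `I`, as an algebra. -/
noncomputable def algSetFlat (I : Type u) : AIAlg.{u} := ⟨SetFlat I⟩

/-! ### Flat semirings of sets as quotients of powers of `S₇` -/

theorem S7.add_of_ne {x y : S7.{u}} (h : x ≠ y) : x + y = S7.infty := by
  revert h
  cases x <;> cases y <;> first | exact fun _ => rfl | exact fun h => absurd rfl h

theorem S7.infty_mul (x : S7.{u}) : S7.infty * x = S7.infty := by cases x <;> rfl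

theorem S7.mul_infty (x : S7.{u}) : x * S7.infty = S7.infty := by cases x <;> rfl

theorem S7.mul_eq_a_iff {x y : S7.{u}} (hx : x ≠ S7.infty) (hy : y ≠ S7.infty)
    (h : x = S7.a → y ≠ S7.a) :
    x * y ≠ S7.infty ∧ (x * y = S7.a ↔ x = S7.a ∨ y = S7.a) := by
  have h1 : (S7.one * S7.one : S7.{u}) = S7.one := rfl
  have h2 : (S7.one * S7.a : S7.{u}) = S7.a := rfl
  have h3 : (S7.a * S7.one : S7.{u}) = S7.a := rfl
  cases x <;> cases y <;> simp_all

theorem S7.eq_of_eq_a_iff {x y : S7.{u}} (hx : x ≠ S7.infty) (hy : y ≠ S7.infty)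
    (h : x = S7.a ↔ y = S7.a) : x = y := by
  cases x <;> cases y <;> simp_all

open scoped Classical in
/-- The element of the flat semiring of sets given by a tuple of elements of `S₇`. -/
noncomputable def SetFlat.ofTuple {I : Type u} (y : I → S7.{u}) : SetFlat I :=
  if ∃ i, y i = S7.infty then SetFlat.zero else SetFlat.of {i | y i = S7.a}

namespace SetFlat

variable {I : Type u} {x y : I → S7.{u}}

theorem ofTuple_eq_zero {i : I} (h : x i = S7.infty) : ofTuple x = zero := if_pos ⟨i, h⟩

theorem ofTuple_eq_of (h : ∀ i, x i ≠ S7.infty) : ofTuple x = of {i | x i = S7.a} :=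
  if_neg fun ⟨i, hi⟩ => h i hi

theorem ofTuple_injective_of_ne_zero (h : ofTuple x = ofTuple y) (h0 : ofTuple x ≠ zero) :
    x = y := by
  have hx : ∀ i, x i ≠ S7.infty := fun i hi => h0 (ofTuple_eq_zero hi)
  have hy : ∀ i, y i ≠ S7.infty := fun i hi => h0 (h ▸ ofTuple_eq_zero hi)
  rw [ofTuple_eq_of hx, ofTuple_eq_of hy] at h
  exact funext fun i => S7.eq_of_eq_a_iff (hx i) (hy i) (Set.ext_iff.1 (of_injective h) i)

theorem ofTuple_add (x y : I → S7.{u}) : ofTuple (fun i => x i + y i) = ofTuple x + ofTuple y := by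
  by_cases hxy : x = y
  · subst hxy
    rw [add_self]
    congr 1
    exact funext fun i => AISemiring.add_idem _
  · obtain ⟨i, hi⟩ := Function.ne_iff.1 hxy
    rw [ofTuple_eq_zero (i := i) (S7.add_of_ne hi)]
    rcases add_eq_zero_or (ofTuple x) (ofTuple y) with h | ⟨h, h'⟩
    · exact h.symm
    · rw [h]
      by_contra k
      exact hxy (ofTuple_injective_of_ne_zero h' (Ne.symm k))

theorem ofTuple_mul (x y : I → S7.{u}) : ofTuple (fun i => x i * y i) = ofTuple x * ofTuple y := by
  by_cases hx : ∃ i, x i = S7.infty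
  · obtain ⟨i, hi⟩ := hx
    rw [ofTuple_eq_zero hi, zero_mul]
    exact ofTuple_eq_zero (i := i) (by rw [hi, S7.infty_mul])
  by_cases hy : ∃ i, y i = S7.infty
  · obtain ⟨i, hi⟩ := hy
    rw [ofTuple_eq_zero hi, mul_zero]
    exact ofTuple_eq_zero (i := i) (by rw [hi, S7.mul_infty])
  push Not at hx hy
  rw [ofTuple_eq_of hx, ofTuple_eq_of hy]
  by_cases h : Disjoint {i | x i = S7.a} {i | y i = S7.a}
  · have key := fun i => S7.mul_eq_a_iff (hx i) (hy i) fun h1 h2 => Set.disjoint_left.1 h h1 h2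
    rw [of_mul_of h, ofTuple_eq_of fun i => (key i).1]
    congr 1
    ext i
    exact (key i).2
  · have h1 : of {i | x i = S7.a} * of {i | y i = S7.a} = zero := by
      by_contra k
      exact h (disjoint_of_mul_ne_zero k)
    obtain ⟨i, h2, h3⟩ := Set.not_disjoint_iff.1 h
    have h2 : x i = S7.a := h2
    have h3 : y i = S7.a := h3
    rw [h1]
    exact ofTuple_eq_zero (i := i) (by rw [h2, h3]; rfl)

theorem ofTuple_surjective [Nonempty I] : Function.Surjective (ofTuple (I := I)) := by
  classical
  intro x
  rcases eq_zero_or_of x with rfl | ⟨X, rfl⟩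
  · exact ⟨fun _ => S7.infty, ofTuple_eq_zero (i := Classical.arbitrary I) rfl⟩
  · refine ⟨fun i => if i ∈ X then S7.a else S7.one, (ofTuple_eq_of fun i => ?_).trans ?_⟩
    · split_ifs <;> simp
    · congr 1
      ext i
      simp

end SetFlat

theorem algSetFlat_mem (I : Type u) [Nonempty I] :
    algSetFlat I ∈ (AIVariety.generatedBy algS7.{u}).mem := fun V hV =>
  V.closed_quot (AIAlg.pi fun _ : I => algS7) (algSetFlat I) SetFlat.ofTuple
    ⟨SetFlat.ofTuple_add, SetFlat.ofTuple_mul⟩ SetFlat.ofTuple_surjective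
    (V.closed_pi I _ fun _ => hV)

/-! ### Subalgebras of flat semirings of sets given by generators -/

section generators

variable {I : Type u} {K : Type*}

/-- The product of a family of generators. -/
noncomputable def genProd (gen : K → Set I) (l : Multiset K) : SetFlat I :=
  (l.map fun k => SetFlat.of (gen k)).prod

variable {gen : K → Set I}

theorem genProd_add (l m : Multiset K) : genProd gen (l + m) = genProd gen l * genProd gen m := by
  rw [genProd, Multiset.map_add, Multiset.prod_add]
  rfl

theorem genProd_cons (k : K) (l : Multiset K) :
    genProd gen (k ::ₘ l) = SetFlat.of (gen k) * genProd gen l := by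
  rw [genProd, Multiset.map_cons, Multiset.prod_cons]
  rfl

theorem genProd_singleton (k : K) : genProd gen {k} = SetFlat.of (gen k) := by
  rw [genProd, Multiset.map_singleton, Multiset.prod_singleton]

/-- Zero and the products of generators. -/
def IsGenProd (gen : K → Set I) (x : SetFlat I) : Prop :=
  x = SetFlat.zero ∨ ∃ l : Multiset K, l ≠ 0 ∧ x = genProd gen l

theorem IsGenProd.mul {x y : SetFlat I} (hx : IsGenProd gen x) (hy : IsGenProd gen y) :
    IsGenProd gen (x * y) := by
  rcases hx with rfl | ⟨l, hl, rfl⟩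
  · exact Or.inl (SetFlat.zero_mul _)
  rcases hy with rfl | ⟨m, hm, rfl⟩
  · exact Or.inl (SetFlat.mul_zero _)
  · exact Or.inr ⟨l + m, fun h => hl (add_eq_zero.1 h).1, (genProd_add l m).symm⟩

theorem IsGenProd.add {x y : SetFlat I} (hx : IsGenProd gen x) : IsGenProd gen (x + y) := by
  rcases SetFlat.add_eq_zero_or x y with h | ⟨h, -⟩
  · exact Or.inl h
  · rwa [h]

theorem IsGenProd.mul_self (hgen : ∀ k, (gen k).Nonempty) {x : SetFlat I}
    (hx : IsGenProd gen x) : x * x = SetFlat.zero := by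
  rcases hx with rfl | ⟨l, hl, rfl⟩
  · exact SetFlat.zero_mul _
  · obtain ⟨k, hk⟩ := Multiset.exists_mem_of_ne_zero hl
    obtain ⟨l, rfl⟩ := Multiset.exists_cons_of_mem hk
    rw [genProd_cons, mul_mul_mul_comm, SetFlat.of_mul_self (hgen k), SetFlat.zero_mul]

theorem IsGenProd.list_prod {L : List (SetFlat I)} (hL : ∀ x ∈ L, IsGenProd gen x)
    (h0 : L.prod ≠ SetFlat.zero) :
    ∃ m : Multiset K, L.length ≤ m.card ∧ L.prod = genProd gen m := by
  induction L with
  | nil => exact ⟨0, by simp, rfl⟩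
  | cons x L ih =>
    rw [List.prod_cons] at h0
    obtain ⟨m, hm, hm'⟩ := ih (fun y hy => hL y (List.mem_cons_of_mem _ hy))
      (SetFlat.right_ne_zero h0)
    rcases hL x List.mem_cons_self with rfl | ⟨l, hl, rfl⟩
    · exact absurd (SetFlat.zero_mul _) h0
    · refine ⟨l + m, ?_, by rw [List.prod_cons, genProd_add, hm']⟩
      have := Multiset.card_pos.2 hl
      rw [List.length_cons, Multiset.card_add]
      omega

/-- If nonzero products of generators have length at most `r`, then in a nonzero product of `r`
elements, every factor is a generator. -/
theorem IsGenProd.exists_eq_of {r : ℕ} (hcard : ∀ l, genProd gen l ≠ SetFlat.zero → l.card ≤ r)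
    {x : SetFlat I} (hx : IsGenProd gen x) {L : List (SetFlat I)} (hL : ∀ x ∈ L, IsGenProd gen x)
    (hr : r ≤ L.length + 1) (h0 : x * L.prod ≠ SetFlat.zero) :
    ∃ k, x = SetFlat.of (gen k) := by
  obtain ⟨m, hm, hm'⟩ := IsGenProd.list_prod hL (SetFlat.right_ne_zero h0)
  rcases hx with rfl | ⟨l, hl, rfl⟩
  · exact absurd (SetFlat.zero_mul _) h0
  · rw [hm', ← genProd_add] at h0
    have h1 := hcard _ h0
    have h2 := Multiset.card_pos.2 hl
    rw [Multiset.card_add] at h1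
    obtain ⟨k, rfl⟩ := Multiset.card_eq_one.1 (show l.card = 1 by omega)
    exact ⟨k, genProd_singleton k⟩

/-- The subalgebra consisting of zero and the products of generators. -/
noncomputable def algGen (gen : K → Set I) : AIAlg.{u} :=
  (algSetFlat I).sub (IsGenProd gen) (fun _ _ hx _ => IsGenProd.add hx)
    (fun _ _ hx hy => IsGenProd.mul hx hy) ⟨SetFlat.zero, Or.inl rfl⟩

namespace algGen

/-- The inclusion into the flat semiring of all sets. -/
noncomputable def val (x : algGen gen) : SetFlat I := AIAlg.sub.val x

theorem isAIHom_val : IsAIHom (val : algGen gen → SetFlat I) :=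
  AIAlg.sub.isAIHom_val

theorem val_injective : Function.Injective (val : algGen gen → SetFlat I) :=
  AIAlg.sub.val_injective

theorem isGenProd_val (x : algGen gen) : IsGenProd gen (val x) := AIAlg.sub.property x

theorem exists_val_eq {x : SetFlat I} (h : IsGenProd gen x) : ∃ y : algGen gen, val y = x :=
  AIAlg.sub.exists_val_eq h

theorem satisfies_iff (s t : AITerm) : SatisfiesIdentity (algGen gen) s t ↔
    ∀ v : ℕ → SetFlat I, (∀ n, IsGenProd gen (v n)) → s.eval v = t.eval v := by
  constructor
  · intro h v hv
    choose w hw using fun n => exists_val_eq (hv n)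
    have h1 := congrArg val (h w)
    rw [AITerm.eval_hom isAIHom_val, AITerm.eval_hom isAIHom_val] at h1
    rwa [show (fun n => val (w n)) = v from funext hw] at h1
  · intro h v
    apply val_injective
    rw [AITerm.eval_hom isAIHom_val, AITerm.eval_hom isAIHom_val]
    exact h _ fun n => isGenProd_val _

theorem mem_of_injective_hom {W : AIVariety.{u}} (h : algGen gen ∈ W.mem) (B : AIAlg.{u})
    {F : B → SetFlat I} (hF : IsAIHom F) (hi : Function.Injective F)
    (hx : ∀ x, IsGenProd gen (F x)) : B ∈ W.mem := by
  choose f hf using fun x => exists_val_eq (hx x)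
  refine W.closed_sub _ _ f ⟨fun x y => ?_, fun x y => ?_⟩ (fun x y hxy => ?_) h
  · apply val_injective
    rw [hf, isAIHom_val.map_add, hf, hf, hF.map_add]
  · apply val_injective
    rw [hf, isAIHom_val.map_mul, hf, hf, hF.map_mul]
  · apply hi
    rw [← hf, ← hf, hxy]

end algGen

theorem exists_eval_prodVars {v : ℕ → SetFlat I} (s k : ℕ) :
    ∃ L : List ℕ, L.length = k + 1 ∧ (AITerm.prodVars s (k + 1)).eval v = (L.map v).prod := by
  induction k with
  | zero => exact ⟨[s], rfl, by rw [List.map_singleton, List.prod_singleton]; rfl⟩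
  | succ k ih =>
    obtain ⟨L, h1, h2⟩ := ih
    refine ⟨L ++ [s + k + 1], by simp [h1], ?_⟩
    rw [List.map_append, List.prod_append, ← h2, List.map_singleton, List.prod_singleton]
    rfl

theorem eval_isGenProd {v : ℕ → SetFlat I} (hv : ∀ n, IsGenProd gen (v n)) (t : AITerm) :
    IsGenProd gen (t.eval v) := by
  induction t with
  | var n => exact hv n
  | add s t hs ht => exact hs.add
  | mul s t hs ht => exact hs.mul ht

/-- Squares vanish because a nonempty set is not disjoint from itself, and a nonzero product of `r +
1` elements would involve at least `r + 1` generators. Both sides of each defining identity are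
therefore zero. -/
theorem algGen_mem_varietyNk [Nonempty I] {r : ℕ} (hgen : ∀ k, (gen k).Nonempty)
    (hcard : ∀ l, genProd gen l ≠ SetFlat.zero → l.card ≤ r) :
    algGen gen ∈ (varietyNk.{u} (r + 1)).mem := by
  refine ⟨⟨AIVariety.sub_mem (algSetFlat_mem I), (algGen.satisfies_iff _ _).2 fun v hv => ?_⟩,
    (algGen.satisfies_iff _ _).2 fun v hv => ?_⟩
  · change v 0 * v 0 * v 1 = v 0 * v 0
    rw [(hv 0).mul_self hgen, SetFlat.zero_mul]
  · have key : ∀ s, (AITerm.prodVars s (r + 1)).eval v = SetFlat.zero := by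
      intro s
      obtain ⟨L, h1, h2⟩ := exists_eval_prodVars (v := v) s r
      rw [h2]
      by_contra h0
      obtain ⟨m, h3, h4⟩ := IsGenProd.list_prod (gen := gen)
        (fun x hx => by obtain ⟨n, -, rfl⟩ := List.mem_map.1 hx; exact hv n) h0
      have h5 := hcard m (h4 ▸ h0)
      rw [List.length_map, h1] at h3
      omega
    rw [key, key]

end generators

/-! ### Identities encoding graphs -/

/-- The sum of a nonempty list of terms. -/
def AITerm.sumList (s : AITerm) : List AITerm → AITerm
  | [] => s
  | t :: L => .add s (t.sumList L)

/-- The product of a nonempty list of terms. -/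
def AITerm.prodList (s : AITerm) : List AITerm → AITerm
  | [] => s
  | t :: L => .mul s (t.prodList L)

theorem AITerm.eval_prodList {I : Type u} (v : ℕ → SetFlat I) (s : AITerm) (L : List AITerm) :
    (s.prodList L).eval v = s.eval v * (L.map fun t => t.eval v).prod := by
  induction L generalizing s with
  | nil => exact (mul_one _).symm
  | cons t L ih =>
    rw [List.map_cons, List.prod_cons, ← ih]
    rfl

theorem AITerm.eval_sumList_of_forall_eq {I : Type u} {v : ℕ → SetFlat I} {c : SetFlat I}
    {s : AITerm} {L : List AITerm} (h : ∀ t ∈ s :: L, t.eval v = c) :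
    (s.sumList L).eval v = c := by
  induction L generalizing s with
  | nil => exact h s List.mem_cons_self
  | cons t L ih =>
    have h1 : s.eval v + (t.sumList L).eval v = c := by
      rw [h s List.mem_cons_self, ih fun t ht => h t (List.mem_cons_of_mem _ ht),
        SetFlat.add_self]
    exact h1

theorem AITerm.eval_ne_zero_of_sumList {I : Type u} {v : ℕ → SetFlat I}
    {s : AITerm} {L : List AITerm} (h : (s.sumList L).eval v ≠ SetFlat.zero) :
    ∀ t ∈ s :: L, t.eval v ≠ SetFlat.zero := by
  induction L generalizing s with
  | nil =>
    intro t ht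
    rw [List.mem_singleton.1 ht]
    exact h
  | cons t L ih =>
    have h0 : s.eval v + (t.sumList L).eval v ≠ SetFlat.zero := h
    rcases SetFlat.add_eq_zero_or (s.eval v) ((t.sumList L).eval v) with h1 | ⟨h1, h2⟩
    · exact absurd h1 h0
    · rw [h1] at h0
      intro t' ht'
      rcases List.mem_cons.1 ht' with rfl | ht'
      · exact h0
      · exact ih (h2 ▸ h0) t' ht'

section graphTerm

variable {V : Type u} [Finite V]

/-- A numbering of variables indexed by the vertices of a graph and, for every arc, by
`s + 1` further indices. -/
noncomputable def graphVar (V : Type u) [Finite V] (s : ℕ) : V ⊕ (V × V) × Fin (s + 1) → ℕ :=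
  (exists_injective_nat (V ⊕ (V × V) × Fin (s + 1))).choose

theorem graphVar_injective (s : ℕ) : Function.Injective (graphVar V s) :=
  (exists_injective_nat (V ⊕ (V × V) × Fin (s + 1))).choose_spec

/-- The word of length `s + 3` of an arc. -/
noncomputable def arcTerm (s : ℕ) (p : V × V) : AITerm :=
  (AITerm.var (graphVar V s (.inl p.1))).prodList
    (.var (graphVar V s (.inl p.2)) :: List.ofFn fun j => .var (graphVar V s (.inr (p, j))))

/-- The list of arcs of a graph. -/
noncomputable def arcList (G : SimpleGraph V) : List (V × V) :=
  (Set.toFinite {p : V × V | G.Adj p.1 p.2}).toFinset.toList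

theorem mem_arcList {G : SimpleGraph V} {p : V × V} : p ∈ arcList G ↔ G.Adj p.1 p.2 := by
  simp [arcList]

/-- The sum of the words of all arcs of a graph (a variable if there are none). -/
noncomputable def graphTerm (s : ℕ) (G : SimpleGraph V) : AITerm :=
  match (arcList G).map (arcTerm s) with
  | [] => .var 0
  | t :: L => t.sumList L

theorem eval_graphTerm_of_forall_eq {I : Type u} {v : ℕ → SetFlat I} {c : SetFlat I} {s : ℕ}
    {G : SimpleGraph V} (hG : ∃ x y, G.Adj x y)
    (h : ∀ p : V × V, G.Adj p.1 p.2 → (arcTerm s p).eval v = c) :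
    (graphTerm s G).eval v = c := by
  have h' : ∀ t ∈ (arcList G).map (arcTerm s), t.eval v = c := by
    intro t ht
    obtain ⟨p, hp, rfl⟩ := List.mem_map.1 ht
    exact h p (mem_arcList.1 hp)
  obtain ⟨x, y, hxy⟩ := hG
  have hne : arcTerm s (x, y) ∈ (arcList G).map (arcTerm s) :=
    List.mem_map_of_mem (mem_arcList.2 hxy)
  rw [graphTerm]
  revert h' hne
  cases (arcList G).map (arcTerm s) with
  | nil => exact fun _ h => absurd h List.not_mem_nil
  | cons t L => exact fun h _ => AITerm.eval_sumList_of_forall_eq h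

theorem eval_arcTerm_ne_zero {I : Type u} {v : ℕ → SetFlat I} {s : ℕ}
    {G : SimpleGraph V} (h : (graphTerm s G).eval v ≠ SetFlat.zero) {p : V × V}
    (hp : G.Adj p.1 p.2) : (arcTerm s p).eval v ≠ SetFlat.zero := by
  have hp : arcTerm s p ∈ (arcList G).map (arcTerm s) :=
    List.mem_map_of_mem (mem_arcList.2 hp)
  rw [graphTerm] at h
  revert h hp
  cases (arcList G).map (arcTerm s) with
  | nil => exact fun _ h => absurd h List.not_mem_nil
  | cons t L => exact fun h hp => AITerm.eval_ne_zero_of_sumList h _ hp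

theorem eval_arcTerm {I : Type u} (v : ℕ → SetFlat I) (s : ℕ) (p : V × V) :
    (arcTerm s p).eval v = v (graphVar V s (.inl p.1)) * (v (graphVar V s (.inl p.2)) ::
      List.ofFn fun j => v (graphVar V s (.inr (p, j)))).prod := by
  rw [arcTerm, AITerm.eval_prodList, List.map_cons, List.map_ofFn]
  rfl

/-- The identity encoding a graph holds in an algebra generated by sets, provided that the vertices
of the graph cannot be mapped to the generators in such a way that adjacent vertices go to
disjoint sets. -/
theorem satisfies_graphTerm {I : Type u} {K : Type*} {gen : K → Set I}
    (hgen : ∀ k, (gen k).Nonempty) {s : ℕ}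
    (hcard : ∀ l, genProd gen l ≠ SetFlat.zero → l.card ≤ s + 3) {G : SimpleGraph V}
    (hG : ∃ x y, G.Adj x y)
    (h : ¬ ∃ h : V → K, ∀ x y, G.Adj x y → Disjoint (gen (h x)) (gen (h y))) :
    SatisfiesIdentity (algGen gen) (graphTerm s G) (.mul (graphTerm s G) (graphTerm s G)) := by
  rw [algGen.satisfies_iff]
  intro v hv
  -- Squares vanish, so the identity asserts that the graph term is always zero.
  have h1 : AITerm.eval v (.mul (graphTerm s G) (graphTerm s G)) = SetFlat.zero :=
    (eval_isGenProd hv (graphTerm s G)).mul_self hgen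
  rw [h1]
  by_contra h0
  have key : ∀ x y, G.Adj x y → ∃ k, v (graphVar V s (.inl x)) = SetFlat.of (gen k) := by
    intro x y hxy
    have h2 := eval_arcTerm_ne_zero h0 (p := (x, y)) hxy
    rw [eval_arcTerm] at h2
    refine IsGenProd.exists_eq_of hcard (hv _) (fun z hz => ?_) ?_ h2
    · rcases List.mem_cons.1 hz with rfl | hz
      · exact hv _
      · obtain ⟨j, rfl⟩ := (List.mem_ofFn' _ _).1 hz
        exact hv _
    · rw [List.length_cons, List.length_ofFn]
  obtain ⟨x₀, y₀, h₀⟩ := hG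
  obtain ⟨k₀, -⟩ := key x₀ y₀ h₀
  -- Isolated vertices occur in no word and are unconstrained; they receive the arbitrary generator
  -- `k₀`.
  have key' : ∀ x, ∃ k, (∃ y, G.Adj x y) → v (graphVar V s (.inl x)) = SetFlat.of (gen k) := by
    intro x
    by_cases hx : ∃ y, G.Adj x y
    · obtain ⟨y, hxy⟩ := hx
      obtain ⟨k, hk⟩ := key x y hxy
      exact ⟨k, fun _ => hk⟩
    · exact ⟨k₀, fun h => absurd h hx⟩
  choose f hf using key'
  refine h ⟨f, fun x y hxy => ?_⟩
  have h2 := eval_arcTerm_ne_zero h0 (p := (x, y)) hxy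
  rw [eval_arcTerm, List.prod_cons, ← mul_assoc] at h2
  have h3 := SetFlat.left_ne_zero h2
  rw [hf x ⟨y, hxy⟩, hf y ⟨x, hxy.symm⟩] at h3
  exact SetFlat.disjoint_of_mul_ne_zero h3

end graphTerm

/-! ### The algebra of a graph -/

section generators

variable {I : Type u} {K : Type*} {gen : K → Set I}

theorem disjoint_of_genProd_ne_zero {l : Multiset K} {k k' : K} (hl : k ::ₘ k' ::ₘ 0 ≤ l)
    (h : genProd gen l ≠ SetFlat.zero) : Disjoint (gen k) (gen k') := by
  obtain ⟨m, rfl⟩ := Multiset.le_iff_exists_add.1 hl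
  rw [genProd_add, genProd_cons, genProd_cons, ← mul_assoc] at h
  exact SetFlat.disjoint_of_mul_ne_zero (SetFlat.left_ne_zero (SetFlat.left_ne_zero h))

theorem nodup_of_genProd_ne_zero (hgen : ∀ k, (gen k).Nonempty) {l : Multiset K}
    (h : genProd gen l ≠ SetFlat.zero) : l.Nodup := by
  rw [Multiset.nodup_iff_le]
  exact fun k hk => (hgen k).ne_empty (disjoint_self.1 (disjoint_of_genProd_ne_zero hk h))

theorem disjoint_of_mem_of_genProd_ne_zero {l : Multiset K} (h : genProd gen l ≠ SetFlat.zero)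
    {k k' : K} (hk : k ∈ l) (hk' : k' ∈ l) (hne : k ≠ k') : Disjoint (gen k) (gen k') := by
  obtain ⟨m, rfl⟩ := Multiset.exists_cons_of_mem hk
  obtain ⟨m, rfl⟩ := Multiset.exists_cons_of_mem
    ((Multiset.mem_cons.1 hk').resolve_left (Ne.symm hne))
  exact disjoint_of_genProd_ne_zero
    (Multiset.cons_le_cons _ (Multiset.cons_le_cons _ (Multiset.zero_le _))) h

end generators

section graphGen

variable {V : Type u} (s : ℕ) (G : SimpleGraph V)

/-- The independent sets of a graph, together with `s` further points. -/
abbrev GraphPoint : Type u := {S : Set V // ∀ x ∈ S, ∀ y ∈ S, ¬ G.Adj x y} ⊕ Fin s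

/-- The vertices and the arcs of a graph, together with `s` further elements. -/
abbrev GraphGen : Type u := V ⊕ ({p : V × V // G.Adj p.1 p.2} ⊕ Fin s)

/-- A vertex gives the family of all independent sets containing it, an arc the family of all
independent sets avoiding both of its end points. -/
def graphGen : GraphGen s G → Set (GraphPoint s G)
  | .inl x => Sum.inl '' {S | x ∈ S.1}
  | .inr (.inl p) => Sum.inl '' {S | p.1.1 ∉ S.1 ∧ p.1.2 ∉ S.1}
  | .inr (.inr j) => {Sum.inr j}

variable {s G}

theorem graphGen_nonempty (k : GraphGen s G) : (graphGen s G k).Nonempty := by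
  rcases k with x | p | j
  · refine ⟨_, ⟨{x}, ?_⟩, rfl, rfl⟩
    rintro _ rfl _ rfl
    exact G.irrefl
  · exact ⟨_, ⟨∅, fun _ h => h.elim⟩, ⟨fun h => h, fun h => h⟩, rfl⟩
  · exact ⟨_, rfl⟩

theorem adj_of_disjoint_graphGen {x y : V}
    (h : Disjoint (graphGen s G (.inl x)) (graphGen s G (.inl y))) : G.Adj x y := by
  by_contra hxy
  have hS : ∀ a ∈ ({x, y} : Set V), ∀ b ∈ ({x, y} : Set V), ¬ G.Adj a b := by
    rintro _ (rfl | rfl) _ (rfl | rfl)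
    · exact G.irrefl
    · exact hxy
    · exact fun h => hxy h.symm
    · exact G.irrefl
  revert h
  exact Set.not_disjoint_iff.2 ⟨.inl ⟨{x, y}, hS⟩, ⟨⟨_, hS⟩, Or.inl rfl, rfl⟩,
    ⟨⟨_, hS⟩, Or.inr rfl, rfl⟩⟩

theorem not_disjoint_graphGen_arc (p q : {p : V × V // G.Adj p.1 p.2}) :
    ¬ Disjoint (graphGen s G (.inr (.inl p))) (graphGen s G (.inr (.inl q))) :=
  have h : ∀ x ∈ (∅ : Set V), ∀ y ∈ (∅ : Set V), ¬ G.Adj x y := fun _ h => h.elim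
  Set.not_disjoint_iff.2 ⟨.inl ⟨∅, h⟩, ⟨⟨∅, h⟩, ⟨fun h => h, fun h => h⟩, rfl⟩,
    ⟨⟨∅, h⟩, ⟨fun h => h, fun h => h⟩, rfl⟩⟩

/-- The factors are distinct and pairwise disjoint. Three vertices would form a triangle, two arcs
share the empty independent set, and there are only `s` points. -/
theorem card_le_of_genProd_graphGen_ne_zero
    (hG : ∀ x y z, G.Adj x y → G.Adj y z → ¬ G.Adj z x) (l : Multiset (GraphGen s G))
    (h : genProd (graphGen s G) l ≠ SetFlat.zero) : l.card ≤ s + 3 := by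
  classical
  have hl := nodup_of_genProd_ne_zero graphGen_nonempty h
  let t : Finset (GraphGen s G) := ⟨l, hl⟩
  have ht : ∀ a ∈ t, ∀ b ∈ t, a ≠ b → Disjoint (graphGen s G a) (graphGen s G b) :=
    fun a ha b hb => disjoint_of_mem_of_genProd_ne_zero h ha hb
  have h1 : t.toLeft.card ≤ 2 := by
    by_contra! h2
    obtain ⟨x, hx, y, hy, z, hz, hxy, hxz, hyz⟩ := Finset.two_lt_card.1 h2
    rw [Finset.mem_toLeft] at hx hy hz
    exact hG x y z (adj_of_disjoint_graphGen (ht _ hx _ hy (by simpa using hxy)))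
      (adj_of_disjoint_graphGen (ht _ hy _ hz (by simpa using hyz)))
      (adj_of_disjoint_graphGen (ht _ hz _ hx (by simpa using Ne.symm hxz)))
  have h2 : t.toRight.toLeft.card ≤ 1 := by
    rw [Finset.card_le_one]
    intro p hp q hq
    rw [Finset.mem_toLeft, Finset.mem_toRight] at hp hq
    by_contra hpq
    exact not_disjoint_graphGen_arc p q (ht _ hp _ hq (by simpa using hpq))
  have h3 : t.toRight.toRight.card ≤ s := by
    simpa using Finset.card_le_univ t.toRight.toRight
  have h4 : t.toLeft.card + t.toRight.card = t.card := Finset.card_toLeft_add_card_toRight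
  have h5 : t.toRight.toLeft.card + t.toRight.toRight.card = t.toRight.card :=
    Finset.card_toLeft_add_card_toRight
  have h6 : t.card = l.card := rfl
  omega

instance : Nonempty (GraphPoint s G) := ⟨.inl ⟨∅, fun _ h => h.elim⟩⟩

/-- An independent set contains exactly one of `x` and `y`, or avoids both, so these generators
partition the whole set. The value is the same for every arc. -/
theorem prod_arc_graphGen {x y : V} (hxy : G.Adj x y) :
    SetFlat.of (graphGen s G (.inl x)) * (SetFlat.of (graphGen s G (.inl y)) ::
      List.ofFn (Fin.cons (SetFlat.of (graphGen s G (.inr (.inl ⟨(x, y), hxy⟩))))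
        fun j : Fin s => SetFlat.of (graphGen s G (.inr (.inr j))))).prod =
      SetFlat.of Set.univ := by
  have h := SetFlat.prod_map_of (L := graphGen s G (.inl x) :: graphGen s G (.inl y) ::
    graphGen s G (.inr (.inl ⟨(x, y), hxy⟩)) ::
    List.ofFn fun j : Fin s => graphGen s G (.inr (.inr j))) ?_
  · rw [List.map_cons, List.prod_cons, List.map_cons, List.map_cons, List.map_ofFn] at h
    rw [List.ofFn_succ, Fin.cons_zero]
    simp only [Fin.cons_succ]
    refine h.trans (congrArg _ (Set.eq_univ_of_forall ?_))
    rintro (S | j)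
    · by_cases hx : x ∈ S.1
      · exact ⟨_, List.mem_cons_self, S, hx, rfl⟩
      by_cases hy : y ∈ S.1
      · exact ⟨_, List.mem_cons_of_mem _ List.mem_cons_self, S, hy, rfl⟩
      · exact ⟨_, List.mem_cons_of_mem _ (List.mem_cons_of_mem _ List.mem_cons_self), S,
          ⟨hx, hy⟩, rfl⟩
    · refine ⟨graphGen s G (.inr (.inr j)), ?_, rfl⟩
      simp only [List.mem_cons, List.mem_ofFn]
      exact Or.inr (Or.inr (Or.inr ⟨j, rfl⟩))
  · have hz : ∀ (T : Set {S : Set V // ∀ x ∈ S, ∀ y ∈ S, ¬ G.Adj x y}),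
        ∀ Z ∈ List.ofFn fun j : Fin s => graphGen s G (.inr (.inr j)),
          Disjoint (Sum.inl '' T : Set (GraphPoint s G)) Z := by
      intro T Z hZ
      obtain ⟨j, rfl⟩ := (List.mem_ofFn' _ _).1 hZ
      rw [Set.disjoint_left]
      rintro _ ⟨S, -, rfl⟩ h
      cases h
    have hd : ∀ T T' : Set {S : Set V // ∀ x ∈ S, ∀ y ∈ S, ¬ G.Adj x y}, Disjoint T T' →
        Disjoint (Sum.inl '' T : Set (GraphPoint s G)) (Sum.inl '' T') := fun T T' h =>
      (Set.disjoint_image_iff Sum.inl_injective).2 h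
    rw [List.pairwise_cons, List.pairwise_cons, List.pairwise_cons, List.forall_mem_cons,
      List.forall_mem_cons, List.forall_mem_cons]
    refine ⟨⟨hd _ _ ?_, hd _ _ ?_, hz _⟩, ⟨hd _ _ ?_, hz _⟩, hz _, ?_⟩
    · exact Set.disjoint_left.2 fun S hx hy => S.2 _ hx _ hy hxy
    · exact Set.disjoint_left.2 fun S hx h => h.1 hx
    · exact Set.disjoint_left.2 fun S hx h => h.2 hx
    · rw [List.pairwise_ofFn]
      intro i j hij
      exact Set.disjoint_singleton.2 fun h => hij.ne (Sum.inr_injective h)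

/-- The identity encoding a graph fails in the algebra of the graph. -/
theorem not_satisfies_graphTerm [Finite V] (hG : ∃ x y, G.Adj x y) :
    ¬ SatisfiesIdentity (algGen (graphGen s G)) (graphTerm s G)
      (.mul (graphTerm s G) (graphTerm s G)) := by
  classical
  rw [algGen.satisfies_iff]
  intro h
  obtain ⟨x₀, y₀, h₀⟩ := hG
  -- Of the `s + 1` extra letters of an arc, the first goes to the arc generator and the others to
  -- the `s` points; indices of non-arcs get a default value.
  let f : V ⊕ (V × V) × Fin (s + 1) → GraphGen s G := fun i => match i with
    | .inl x => .inl x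
    | .inr (p, j) => if hp : G.Adj p.1 p.2 then
        (Fin.cons (.inr (.inl ⟨p, hp⟩)) fun j => .inr (.inr j) : Fin (s + 1) → GraphGen s G) j
      else .inl x₀
  let v : ℕ → SetFlat (GraphPoint s G) := fun n =>
    SetFlat.of (graphGen s G (Function.extend (graphVar V s) f (fun _ => .inl x₀) n))
  have hv : ∀ i, v (graphVar V s i) = SetFlat.of (graphGen s G (f i)) := fun i => by
    change SetFlat.of (graphGen s G (Function.extend _ _ _ _)) = _
    rw [(graphVar_injective s).extend_apply]
  have h1 : (graphTerm s G).eval v = SetFlat.of Set.univ := by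
    refine eval_graphTerm_of_forall_eq ⟨x₀, y₀, h₀⟩ ?_
    rintro ⟨x, y⟩ hxy
    rw [eval_arcTerm, hv, hv, ← prod_arc_graphGen hxy]
    congr 4
    funext j
    rw [hv]
    change SetFlat.of (graphGen s G (dite _ _ _)) = _
    rw [dif_pos hxy]
    refine Fin.cases ?_ (fun j => ?_) j <;> rfl
  have h2 := h v fun n => Or.inr ⟨_, Multiset.singleton_ne_zero _, (genProd_singleton _).symm⟩
  have h3 : SetFlat.of (Set.univ : Set (GraphPoint s G)) =
      SetFlat.of Set.univ * SetFlat.of Set.univ := by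
    rw [← h1]
    exact h2
  rw [SetFlat.of_mul_self Set.univ_nonempty] at h3
  exact SetFlat.of_ne_zero _ h3

theorem exists_adj_of_not_colorable {r : ℕ} (hr : 0 < r) (h : ¬ G.Colorable r) :
    ∃ x y, G.Adj x y := by
  by_contra! hG
  exact h ⟨SimpleGraph.Coloring.mk (fun _ => ⟨0, hr⟩) fun {x y} hxy => absurd hxy (hG x y)⟩

/-- Mapping adjacent vertices to disjoint generators colors a graph by the generators. -/
theorem colorable_of_disjoint [Finite V] {V' : Type u} {G' : SimpleGraph V'}
    (h : V' → GraphGen s G)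
    (hh : ∀ x y, G'.Adj x y → Disjoint (graphGen s G (h x)) (graphGen s G (h y))) :
    G'.Colorable (Nat.card (GraphGen s G)) := by
  have := Fintype.ofFinite (GraphGen s G)
  rw [Nat.card_eq_fintype_card]
  refine (SimpleGraph.Coloring.mk h fun {x y} hxy he => ?_).colorable
  have h1 := hh x y hxy
  rw [he] at h1
  exact (graphGen_nonempty _).ne_empty (disjoint_self.1 h1)

/-- The vertices sent to vertex generators are colored by 2 colors through the bipartite induced
subgraph, those sent to arcs share one color as arc generators always meet, and each of the `s`
points is a color of its own. -/
theorem colorable_of_disjoint_of_induce {V' : Type u} {G' : SimpleGraph V'}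
    (hG' : ∀ S : Set V', Nonempty (G'.induce S →g G) → (G'.induce S).Colorable 2)
    (h : V' → GraphGen s G)
    (hh : ∀ x y, G'.Adj x y → Disjoint (graphGen s G (h x)) (graphGen s G (h y))) :
    G'.Colorable (s + 3) := by
  classical
  let S : Set V' := {x | ∃ y, h x = .inl y}
  choose g hg using fun x : S => x.2
  obtain ⟨C⟩ := hG' S ⟨⟨g, fun {x y} hxy => by
    have h1 := hh x y hxy
    rw [hg, hg] at h1
    exact adj_of_disjoint_graphGen h1⟩⟩
  -- Outside `S` the value of `h` is not a vertex, so the color `.inl 0` in the second branch is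
  -- never used.
  let D : V' → Fin 2 ⊕ (Unit ⊕ Fin s) := fun x =>
    if hx : x ∈ S then .inl (C ⟨x, hx⟩) else (h x).elim (fun _ => .inl 0)
      fun k => .inr (k.elim (fun _ => .inl ()) .inr)
  have hD : ∀ x y, G'.Adj x y → D x ≠ D y := by
    intro x y hxy he
    by_cases hx : x ∈ S <;> by_cases hy : y ∈ S
    · simp only [D, dif_pos hx, dif_pos hy, Sum.inl.injEq] at he
      exact C.valid (v := ⟨x, hx⟩) (w := ⟨y, hy⟩) hxy he
    · simp only [D, dif_pos hx, dif_neg hy] at he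
      rcases hk : h y with z | k
      · exact hy ⟨z, hk⟩
      · simp [hk] at he
    · simp only [D, dif_neg hx, dif_pos hy] at he
      rcases hk : h x with z | k
      · exact hx ⟨z, hk⟩
      · simp [hk] at he
    · simp only [D, dif_neg hx, dif_neg hy] at he
      have h1 := hh x y hxy
      rcases hk : h x with z | p | j
      · exact hx ⟨z, hk⟩
      · rcases hk' : h y with z' | p' | j'
        · exact hy ⟨z', hk'⟩
        · rw [hk, hk'] at h1
          exact not_disjoint_graphGen_arc p p' h1
        · simp [hk, hk'] at he
      · rcases hk' : h y with z' | p' | j'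
        · exact hy ⟨z', hk'⟩
        · simp [hk, hk'] at he
        · simp only [hk, hk', Sum.elim_inr, Sum.inr.injEq] at he
          rw [hk, hk', he] at h1
          exact (graphGen_nonempty _).ne_empty (disjoint_self.1 h1)
  have := (SimpleGraph.Coloring.mk (G := G') D fun {x y} hxy => hD x y hxy).colorable
  refine this.mono ?_
  simp
  omega

end graphGen

/-! ### The flat semirings of a linear word -/

section linear

variable {r : ℕ}

/-- The letters, as one-element sets. -/
def letterGen (r : ℕ) (i : ULift.{u} (Fin r)) : Set (ULift.{u} (Fin r)) := {i}

theorem letterGen_nonempty (i : ULift.{u} (Fin r)) : (letterGen r i).Nonempty :=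
  Set.singleton_nonempty i

theorem genProd_letterGen {m : Multiset (ULift.{u} (Fin r))} (hm : m.Nodup) :
    genProd (letterGen r) m = SetFlat.of {i | i ∈ m} := by
  induction m using Multiset.induction with
  | empty =>
    change SetFlat.of ∅ = _
    congr 1
    ext i
    simp
  | cons i m ih =>
    rw [Multiset.nodup_cons] at hm
    have hd : Disjoint (letterGen r i) {j | j ∈ m} := Set.disjoint_singleton_left.2 hm.1
    rw [genProd_cons, ih hm.2, SetFlat.of_mul_of hd]
    congr 1
    ext j
    simp [letterGen]

theorem card_le_of_genProd_letterGen_ne_zero (m : Multiset (ULift.{u} (Fin r)))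
    (h : genProd (letterGen r) m ≠ SetFlat.zero) : m.card ≤ r := by
  have hm := nodup_of_genProd_ne_zero letterGen_nonempty h
  have := Finset.card_le_univ (⟨m, hm⟩ : Finset (ULift.{u} (Fin r)))
  simpa using this

theorem isSubword_linear {m : Multiset (ULift.{u} (Fin r))} :
    IsSubword {(Finset.univ : Finset (ULift.{u} (Fin r))).val} m ↔ m ≠ 0 ∧ m.Nodup := by
  constructor
  · rintro ⟨h, w, rfl, hw⟩
    exact ⟨h, Multiset.nodup_of_le hw Finset.univ.nodup⟩
  · rintro ⟨h, hm⟩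
    exact ⟨h, _, rfl, (Multiset.le_iff_subset hm).2 fun i _ => Finset.mem_univ i⟩

/-- The embedding of `S_c(a₁⋯a_r)` into the flat semiring of all sets of letters. -/
noncomputable def scLinearHom (r : ℕ) :
    Sc {(Finset.univ : Finset (ULift.{u} (Fin r))).val} → SetFlat (ULift.{u} (Fin r))
  | .zero => SetFlat.zero
  | .word m _ => genProd (letterGen r) m

theorem scLinearHom_injective : Function.Injective (scLinearHom.{u} r) := by
  have h0 : ∀ m (h : IsSubword {(Finset.univ : Finset (ULift.{u} (Fin r))).val} m),
      scLinearHom r (.word m h) = SetFlat.of {i | i ∈ m} := fun m h =>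
    genProd_letterGen (isSubword_linear.1 h).2
  intro x y hxy
  cases x with
  | zero =>
    cases y with
    | zero => rfl
    | word m hm =>
      rw [h0] at hxy
      exact absurd hxy.symm (SetFlat.of_ne_zero _)
  | word l hl =>
    cases y with
    | zero =>
      rw [h0] at hxy
      exact absurd hxy (SetFlat.of_ne_zero _)
    | word m hm =>
      rw [h0, h0] at hxy
      have h1 := Set.ext_iff.1 (SetFlat.of_injective hxy)
      have h2 : l = m := (Multiset.Nodup.ext (isSubword_linear.1 hl).2
        (isSubword_linear.1 hm).2).2 h1
      subst h2
      rfl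

theorem isAIHom_scLinearHom : IsAIHom (scLinearHom.{u} r) := by
  constructor
  · intro x y
    by_cases hxy : x = y
    · subst hxy
      rw [SetFlat.add_self, AISemiring.add_idem]
    · rw [SetFlat.add_of_ne fun h => hxy (scLinearHom_injective h)]
      exact congrArg (scLinearHom r) (Sc.add_ne hxy)
  · intro x y
    change scLinearHom r (Sc.mul x y) = _
    cases x with
    | zero =>
      rw [Sc.zero_mul]
      exact (SetFlat.zero_mul _).symm
    | word l hl =>
      cases y with
      | zero =>
        rw [Sc.mul_zero]
        exact (SetFlat.mul_zero _).symm
      | word m hm =>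
        rw [Sc.word_mul_word]
        refine Eq.trans ?_ (genProd_add l m)
        by_cases h : IsSubword {(Finset.univ : Finset (ULift.{u} (Fin r))).val} (l + m)
        · rw [Sc.ofWord_of h]
          rfl
        · rw [Sc.ofWord_of_not h]
          symm
          by_contra k
          exact h (isSubword_linear.2 ⟨fun h => hl.1 (add_eq_zero.1 h).1,
            nodup_of_genProd_ne_zero letterGen_nonempty k⟩)

theorem algScLinear_mem {W : AIVariety.{u}} (h : algGen (letterGen.{u} r) ∈ W.mem) :
    algScLinear.{u} r ∈ W.mem := by
  have hx : ∀ x, IsGenProd (letterGen r) (scLinearHom.{u} r x) := by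
    intro x
    cases x with
    | zero => exact Or.inl rfl
    | word m hm => exact Or.inr ⟨m, hm.1, rfl⟩
  exact algGen.mem_of_injective_hom h (algScLinear r) isAIHom_scLinearHom scLinearHom_injective hx

theorem colorable_of_disjoint_letterGen {V : Type u} {G : SimpleGraph V}
    (h : V → ULift.{u} (Fin r))
    (hh : ∀ x y, G.Adj x y → Disjoint (letterGen r (h x)) (letterGen r (h y))) :
    G.Colorable r :=
  ⟨SimpleGraph.Coloring.mk (fun x => (h x).down) fun {x y} hxy he =>
    Set.disjoint_singleton.1 (hh x y hxy) (ULift.down_injective he)⟩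

end linear

/-! ### Intervals of varieties -/

/-- The subvariety of `V` determined by a set of identities. -/
def AIVariety.determinedBySet (V : AIVariety.{u}) (E : Set (AITerm × AITerm)) : AIVariety.{u} where
  mem := {A | A ∈ V.mem ∧ ∀ p ∈ E, SatisfiesIdentity A p.1 p.2}
  closed_sub A B f hf hi h := ⟨V.closed_sub A B f hf hi h.1, fun p hp =>
    ((V.determinedBy p.1 p.2).closed_sub A B f hf hi ⟨h.1, h.2 p hp⟩).2⟩
  closed_quot A B f hf hs h := ⟨V.closed_quot A B f hf hs h.1, fun p hp =>
    ((V.determinedBy p.1 p.2).closed_quot A B f hf hs ⟨h.1, h.2 p hp⟩).2⟩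
  closed_pi I A h := ⟨V.closed_pi I A fun i => (h i).1, fun p hp =>
    ((V.determinedBy p.1 p.2).closed_pi I A fun i => ⟨(h i).1, (h i).2 p hp⟩).2⟩

theorem AIVariety.generatedBy_le {A : AIAlg.{u}} {V : AIVariety.{u}} (h : A ∈ V.mem) :
    AIVariety.generatedBy A ≤ V := fun _ hB => hB V h

theorem varietyNk_le (k : ℕ) : varietyNk.{u} k ≤ AIVariety.generatedBy algS7.{u} :=
  fun _ h => h.1.1

/-- The interval contains a copy of the lattice of all sets of natural numbers. -/
theorem exists_embedding_interval (r : ℕ) (hr : 2 < r) :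
    ∃ F : Set ℕ → AIVariety.{u}, (∀ A B, F A ≤ F B ↔ A ⊆ B) ∧
      ∀ A, F A ∈ Set.Icc (AIVariety.generatedBy (algScLinear.{u} r)) (varietyNk.{u} (r + 1)) := by
  -- A word spends two letters on the ends of an arc and one on the arc itself, leaving `s = r - 3`
  -- points.
  obtain ⟨s, rfl⟩ : ∃ s, r = s + 3 := ⟨r - 3, by omega⟩
  obtain ⟨V, hV, G, hcol, htri, hlarge, hodd⟩ :=
    exists_seq_graphs.{u} (s + 3) hr fun V G => Nat.card (GraphGen s G)
  have hadj : ∀ n, ∃ x y, (G n).Adj x y := fun n =>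
    exists_adj_of_not_colorable (Nat.succ_pos _) (hcol n)
  let t : ℕ → AITerm := fun n => graphTerm s (G n)
  have hcard : ∀ n l, genProd (graphGen s (G n)) l ≠ SetFlat.zero → l.card ≤ s + 3 := fun n =>
    card_le_of_genProd_graphGen_ne_zero (htri n)
  have hsat : ∀ i n, i ≠ n →
      SatisfiesIdentity (algGen (graphGen s (G n))) (t i) (.mul (t i) (t i)) := by
    intro i n hin
    refine satisfies_graphTerm graphGen_nonempty (hcard n) (hadj i) ?_
    rintro ⟨h, hh⟩
    rcases lt_or_gt_of_ne hin with hlt | hlt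
    · exact hcol i (colorable_of_disjoint_of_induce (hodd i n hlt) h hh)
    · exact hlarge n i hlt (colorable_of_disjoint h hh)
  have hmem : ∀ n, algGen (graphGen s (G n)) ∈ (varietyNk.{u} (s + 3 + 1)).mem := fun n =>
    algGen_mem_varietyNk graphGen_nonempty (hcard n)
  have : Nonempty (ULift.{u} (Fin (s + 3))) := ⟨⟨0⟩⟩
  -- Identities are imposed for indices outside `A`, so the algebra of the graph with index `n`
  -- belongs to the variety exactly when `n ∈ A`.
  refine ⟨fun A => (varietyNk (s + 3 + 1)).determinedBySet
    {p | ∃ n, n ∉ A ∧ p = (t n, .mul (t n) (t n))}, fun A B => ⟨fun h n hn => ?_, ?_⟩, fun A =>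
    ⟨AIVariety.generatedBy_le (algScLinear_mem ⟨?_, ?_⟩), fun _ h => h.1⟩⟩
  · by_contra hB
    have h1 : algGen (graphGen s (G n)) ∈ ((varietyNk (s + 3 + 1)).determinedBySet
        {p | ∃ n, n ∉ A ∧ p = (t n, .mul (t n) (t n))}).mem := by
      refine ⟨hmem n, ?_⟩
      rintro _ ⟨i, hi, rfl⟩
      exact hsat i n fun h => hi (h ▸ hn)
    exact not_satisfies_graphTerm (hadj n) ((h h1).2 _ ⟨n, hB, rfl⟩)
  · rintro h S ⟨h1, h2⟩
    refine ⟨h1, ?_⟩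
    rintro _ ⟨n, hn, rfl⟩
    exact h2 _ ⟨n, fun h' => hn (h h'), rfl⟩
  · exact algGen_mem_varietyNk letterGen_nonempty card_le_of_genProd_letterGen_ne_zero
  · rintro _ ⟨n, -, rfl⟩
    refine satisfies_graphTerm letterGen_nonempty card_le_of_genProd_letterGen_ne_zero (hadj n) ?_
    rintro ⟨h, hh⟩
    exact hcol n (colorable_of_disjoint_letterGen h hh)

/-! ### Chains and antichains of sets of natural numbers, and the conclusion -/

theorem mk_range_eq_continuum {α : Type} (hα : Cardinal.mk α = Cardinal.continuum)
    {F : α → AIVariety.{u}} (hF : Function.Injective F) :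
    Cardinal.mk (Set.range F) = Cardinal.continuum := by
  have h := Cardinal.mk_range_eq_of_injective hF
  rw [hα, Cardinal.lift_continuum] at h
  simpa using h

/-- Dedekind cuts, with the rationals enumerated by natural numbers. -/
theorem exists_strictMono_real_set_nat : ∃ D : ℝ → Set ℕ, StrictMono D := by
  let e := Denumerable.eqv ℚ
  refine ⟨fun x => {n | ((e.symm n : ℚ) : ℝ) < x}, fun x y hxy =>
    (Set.ssubset_iff_of_subset fun n hn => lt_trans hn hxy).2 ?_⟩
  obtain ⟨q, h1, h2⟩ := exists_rat_btwn hxy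
  refine ⟨e q, ?_, ?_⟩
  · change ((e.symm (e q) : ℚ) : ℝ) < y
    rwa [e.symm_apply_apply]
  · change ¬ ((e.symm (e q) : ℚ) : ℝ) < x
    rw [e.symm_apply_apply]
    exact h1.not_gt

/-- Even numbers record `A` and odd numbers its complement, so inclusion of codes gives inclusion
both ways. -/
theorem exists_antichain_set_nat : ∃ D : Set ℕ → Set ℕ, ∀ A B, D A ⊆ D B → A = B := by
  refine ⟨fun A => {n | (Even n ∧ n / 2 ∈ A) ∨ (Odd n ∧ n / 2 ∉ A)}, fun A B h => ?_⟩
  ext n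
  constructor
  · intro hn
    rcases @h (2 * n) (Or.inl ⟨even_two_mul n, by simpa using hn⟩) with h1 | h1
    · simpa using h1.2
    · exact absurd (even_two_mul n) (Nat.not_even_iff_odd.2 h1.1)
  · intro hn
    by_contra hn'
    have h2 : (2 * n + 1) / 2 = n := by omega
    rcases @h (2 * n + 1) (Or.inr ⟨odd_two_mul_add_one n, by rwa [h2]⟩) with h1 | h1
    · exact absurd h1.1 (Nat.not_even_iff_odd.2 (odd_two_mul_add_one n))
    · rw [h2] at h1
      exact h1.2 hn

theorem mainTheorem2 :
    (∀ r : ℕ, 2 < r →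
      Cardinal.mk (Set.Icc (AIVariety.generatedBy (algScLinear.{u} r)) (varietyNk.{u} (r + 1))) =
          Cardinal.continuum ∧
      (∃ C ⊆ Set.Icc (AIVariety.generatedBy (algScLinear.{u} r)) (varietyNk.{u} (r + 1)),
        IsChain (· ≤ ·) C ∧ Cardinal.mk C = Cardinal.continuum) ∧
      (∃ C ⊆ Set.Icc (AIVariety.generatedBy (algScLinear.{u} r)) (varietyNk.{u} (r + 1)),
        IsAntichain (· ≤ ·) C ∧ Cardinal.mk C = Cardinal.continuum)) ∧
    Cardinal.mk (Set.Iic (AIVariety.generatedBy algS7.{u})) = Cardinal.continuum := by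
  have hinj : ∀ F : Set ℕ → AIVariety.{u}, (∀ A B, F A ≤ F B ↔ A ⊆ B) → Function.Injective F :=
    fun F hF A B h => subset_antisymm ((hF A B).1 h.le) ((hF B A).1 h.ge)
  refine ⟨fun r hr => ?_, ?_⟩
  · obtain ⟨F, hF, hmem⟩ := exists_embedding_interval.{u} r hr
    refine ⟨le_antisymm (AIVariety.mk_le_continuum _) ?_, ?_, ?_⟩
    · rw [← mk_range_eq_continuum Cardinal.mk_set_nat (hinj F hF)]
      exact Cardinal.mk_le_mk_of_subset (Set.range_subset_iff.2 hmem)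
    · obtain ⟨D, hD⟩ := exists_strictMono_real_set_nat
      refine ⟨Set.range (F ∘ D), Set.range_subset_iff.2 fun x => hmem _, ?_,
        mk_range_eq_continuum Cardinal.mk_real ((hinj F hF).comp hD.injective)⟩
      rintro _ ⟨x, rfl⟩ _ ⟨y, rfl⟩ -
      exact (le_total x y).imp (fun h => (hF _ _).2 (hD.monotone h))
        fun h => (hF _ _).2 (hD.monotone h)
    · obtain ⟨D, hD⟩ := exists_antichain_set_nat
      refine ⟨Set.range (F ∘ D), Set.range_subset_iff.2 fun x => hmem _, ?_,
        mk_range_eq_continuum Cardinal.mk_set_nat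
          ((hinj F hF).comp fun A B h => hD A B h.subset)⟩
      rintro _ ⟨A, rfl⟩ _ ⟨B, rfl⟩ hne hle
      exact hne (congrArg (F ∘ D) (hD A B ((hF _ _).1 hle)))
  -- Any `r > 2` would do, since each of these intervals lies below the variety generated by `S₇`.
  · obtain ⟨F, hF, hmem⟩ := exists_embedding_interval.{u} 3 (by decide)
    refine le_antisymm (AIVariety.mk_le_continuum _) ?_
    rw [← mk_range_eq_continuum Cardinal.mk_set_nat (hinj F hF)]
    exact Cardinal.mk_le_mk_of_subset
      (Set.range_subset_iff.2 fun A => (hmem A).2.trans (varietyNk_le _))
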